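/- Let $X$ be a connected (Hausdorff, second countable, finite-dimensional) smooth manifold, $\mathcal C^\infty_X$ its sheaf of smooth real functions and $T^*_X$ its cotangent bundle. Let $Q=(Q_0,Q_1,s,t)$ be a finite quiver and fix smooth real vector bundles $M=\{M_a\}_{a\in Q_1}$ over $X$. An $M$-twisted quiver bundle $\mathcal R=(\mathcal E,\phi)$ consists of smooth vector bundles $\mathcal E_i$ ($i\in Q_0$) and vector bundle morphisms $\phi_a:\mathcal E_{s(a)}\otimes M_a\to\mathcal E_{t(a)}$ ($a\in Q_1$); a morphism $f:(\mathcal E,\phi)\to(\mathcal E',\phi')$ is a family $f_i:\mathcal E_i\to\mathcal E'_i$ with $f_{t(a)}\circ\phi_a=\phi'_a\circ(f_{s(a)}\otimes\mathrm{id}_{M_a})$ for all $a$. Replacing vector bundles by sheaves of $\mathcal C^\infty_X$-modules in the data $\mathcal E_i$, one obtains the abelian category of $M$-twisted quiver sheaves, which contains the $M$-twisted quiver bundles as a full subcategory (through sheaves of smooth sections) and in which $\mathrm{Ext}^1$ below is taken. Fix smooth connections $\nabla_1=\{\nabla_a\}_{a\in Q_1}$ on the bundles $M_a$ and an $M$-twisted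 quiver bundle $\mathcal R=(\mathcal E,\phi)$. Let $T^*_X\otimes\mathcal R$ be the $M$-twisted quiver bundle $(T^*_X\otimes\mathcal E_i,\ \mathrm{id}_{T^*_X}\otimes\phi_a)$. Let $J^1\mathcal R$ be the first jet $M$-twisted quiver bundle with respect to $\nabla_1$: at a vertex $i$ it is $J^1\mathcal E_i=\mathcal E_i\oplus(T^*_X\otimes\mathcal E_i)$ with the $\mathcal C^\infty_X$-module structure $f\cdot(s,\tau)=(fs,\ f\tau+df\otimes s)$, and its structure morphisms are $$\tilde\phi_a\big((s,\tau)\otimes m\big)=\big(\phi_a(s\otimes m),\ (\mathrm{id}_{T^*_X}\otimes\phi_a)(\tau\otimes m+s\otimes\nabla_a m)\big).$$ With $\alpha(\tau)=(0,\tau)$ and $\beta(s,\tau)=s$ there is a short exact sequence $$0\longrightarrow T^*_X\otimes\mathcal R\overset{\alpha}{\longrightarrow}J^1\mathcal R\overset{\beta}{\longrightarrow}\mathcal R\longrightarrow 0.\qquad(*)$$ Let $\delta:\mathrm{Hom}(\mathcal R,\mathcal R)\to\mathrm{Ext}^1(\mathcal R,T^*_X\otimes\mathcal R)$ be the connecting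 map of the long exact sequence obtained by applying $\mathrm{Hom}(\mathcal R,-)$ to $(*)$; the Atiyah class of $\mathcal R$ is $\delta(\mathrm{id}_{\mathcal R})$. A smooth relative connection on $\mathcal R$ consists of smooth connections $\nabla_i$ on $\mathcal E_i$ ($i\in Q_0$) and smooth connections on $M_a$ ($a\in Q_1$), such that for every $a\in Q_1$, writing $\nabla'_a$ for the connection on $M_a$, $$\nabla_{t(a)}\circ\phi_a=(\mathrm{id}_{T^*_X}\otimes\phi_a)\circ(\nabla_{s(a)}\otimes\mathrm{id}_{M_a}+\mathrm{id}_{\mathcal E_{s(a)}}\otimes\nabla'_a).$$ Then the following statements are equivalent: 1. The sequence $(*)$ splits. 2. $\mathcal R$ admits a smooth relative connection whose collection of connections on the bundles $M_a$ is $\nabla_1$. 3. The Atiyah class of $\mathcal R$ vanishes. -/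

import Mathlib

/-! Twisted quiver sheaves of modules over a sheaf of rings and the abelian category that they form;
smooth vector bundles, their sheaves of sections, connections and first jets; twisted quiver bundles,
relative connections, the first jet sequence and the Atiyah class. -/

universe u v w₀ w₁

open scoped ContDiff

namespace TwistedQuiver

open CategoryTheory Limits Opposite TopologicalSpace
open scoped ZeroObject Manifold TensorProduct

section Bilinear

variable {C : Type u} [Category.{u} C] {J : GrothendieckTopology C} {R : Sheaf J RingCat.{u}}

/-- The restriction maps of a sheaf of modules. -/
noncomputable def res (N : SheafOfModules.{u} R) {U V : Cᵒᵖ} (i : U ⟶ V) :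
    N.val.obj U →+ N.val.obj V :=
  (N.val.presheaf.map i).hom

/-- The map on sections over `U` induced by a morphism of sheaves of modules. -/
noncomputable def ev {N N' : SheafOfModules.{u} R} (f : N ⟶ N') (U : Cᵒᵖ) :
    N.val.obj U →ₗ[R.obj.obj U] N'.val.obj U :=
  (f.val.app U).hom

section Sections

variable {N N' N'' : SheafOfModules.{u} R}

lemma res_comp (N : SheafOfModules.{u} R) {U V W : Cᵒᵖ} (i : U ⟶ V) (j : V ⟶ W)
    (n : N.val.obj U) : res N (i ≫ j) n = res N j (res N i n) :=
  PresheafOfModules.map_comp_apply N.val i j n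

lemma res_smul (N : SheafOfModules.{u} R) {U V : Cᵒᵖ} (i : U ⟶ V) (r : R.obj.obj U)
    (n : N.val.obj U) : res N i (r • n) = R.obj.map i r • res N i n :=
  PresheafOfModules.map_smul N.val i r n

lemma ev_res (f : N ⟶ N') {U V : Cᵒᵖ} (i : U ⟶ V) (n : N.val.obj U) :
    ev f V (res N i n) = res N' i (ev f U n) :=
  PresheafOfModules.naturality_apply f.val i n

@[simp] lemma ev_comp (f : N ⟶ N') (g : N' ⟶ N'') (U : Cᵒᵖ) (n : N.val.obj U) :
    ev (f ≫ g) U n = ev g U (ev f U n) := rfl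

@[simp] lemma ev_id (U : Cᵒᵖ) (n : N.val.obj U) : ev (𝟙 N) U n = n := rfl

@[simp] lemma ev_zero (U : Cᵒᵖ) (n : N.val.obj U) : ev (0 : N ⟶ N') U n = 0 := rfl

@[simp] lemma ev_add (f g : N ⟶ N') (U : Cᵒᵖ) (n : N.val.obj U) :
    ev (f + g) U n = ev f U n + ev g U n := rfl

lemma hom_ext_ev {f g : N ⟶ N'} (h : ∀ (U : Cᵒᵖ) (n : N.val.obj U), ev f U n = ev g U n) :
    f = g := by
  ext U n
  exact h U n

lemma sep (N : SheafOfModules.{u} R) {U : Cᵒᵖ} (S : Sieve U.unop) (hS : S ∈ J U.unop)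
    {x y : N.val.obj U}
    (h : ∀ ⦃V : C⦄ (i : V ⟶ U.unop), S i → res N i.op x = res N i.op y) : x = y :=
  N.isSheaf.isSeparated _ S hS x y h

lemma glue (N : SheafOfModules.{u} R) {U : Cᵒᵖ} (S : Sieve U.unop) (hS : S ∈ J U.unop)
    (x : ∀ ⦃V : C⦄ (i : V ⟶ U.unop), S i → N.val.obj (op V))
    (hx : ∀ ⦃V W : C⦄ (i : V ⟶ U.unop) (j : W ⟶ V) (hi : S i),
      res N j.op (x i hi) = x (j ≫ i) (S.downward_closed hi j)) :
    ∃ y : N.val.obj U, ∀ ⦃V : C⦄ (i : V ⟶ U.unop) (hi : S i), res N i.op y = x i hi := by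
  have h := (Presheaf.isSheaf_iff_isSheaf_comp J N.val.presheaf (forget AddCommGrpCat)).1 N.isSheaf
  rw [isSheaf_iff_isSheaf_of_type] at h
  have hx' : Presieve.FamilyOfElements.Compatible
      (P := N.val.presheaf ⋙ forget AddCommGrpCat) (fun V i hi => x i hi) :=
    (Presieve.compatible_iff_sieveCompatible
      (P := N.val.presheaf ⋙ forget AddCommGrpCat) _).2 fun V W i j hi => (hx i j hi).symm
  exact ⟨_, fun V i hi => (h S hS).valid_glue hx' i hi⟩

/-- Constructor for morphisms of sheaves of modules. -/
noncomputable def mkHom (f : ∀ U : Cᵒᵖ, N.val.obj U →+ N'.val.obj U)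
    (hs : ∀ (U : Cᵒᵖ) (r : R.obj.obj U) (n : N.val.obj U), f U (r • n) = r • f U n)
    (hr : ∀ {U V : Cᵒᵖ} (i : U ⟶ V) (n : N.val.obj U), f V (res N i n) = res N' i (f U n)) :
    N ⟶ N' where
  val := PresheafOfModules.homMk
    { app := fun U => AddCommGrpCat.ofHom (f U)
      naturality := fun U V i => by
        ext n
        exact hr i n } hs

@[simp] lemma ev_mkHom (f : ∀ U : Cᵒᵖ, N.val.obj U →+ N'.val.obj U) (hs) (hr) (U : Cᵒᵖ)
    (n : N.val.obj U) : ev (mkHom (N := N) (N' := N') f hs hr) U n = f U n := rfl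

lemma mono_of_ev_injective (f : N ⟶ N') (h : ∀ U, Function.Injective (ev f U)) : Mono f where
  right_cancellation _ _ w := hom_ext_ev fun U n => h U congr(ev $w U n)

lemma epi_of_ev_surjective (f : N ⟶ N') (h : ∀ U, Function.Surjective (ev f U)) : Epi f where
  left_cancellation _ _ w := hom_ext_ev fun U n => by
    obtain ⟨n, rfl⟩ := h U n
    exact congr(ev $w U n)

lemma exists_factor (f : N ⟶ N') (h : ∀ U, Function.Injective (ev f U)) (g : N'' ⟶ N')
    (hg : ∀ (U : Cᵒᵖ) (n : N''.val.obj U), ∃ y, ev f U y = ev g U n) : ∃ l, l ≫ f = g := by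
  choose l hl using hg
  refine ⟨mkHom (fun U => AddMonoidHom.mk' (l U) fun a b => h U ?_) (fun U r n => h U ?_)
    (fun {U V} i n => h V ?_), hom_ext_ev hl⟩
  · simp [hl]
  · simp [hl]
  · simp [hl, ev_res]

lemma ev_injective_of_mono (f : N ⟶ N') [Mono f] (U : Cᵒᵖ) : Function.Injective (ev f U) := by
  have : Mono ((SheafOfModules.evaluation R U).map f) := inferInstance
  rwa [ModuleCat.mono_iff_injective] at this

variable [HasSheafify J AddCommGrpCat.{u}] [J.WEqualsLocallyBijective AddCommGrpCat.{u}]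

lemma exists_local_lift_of_epi (f : N ⟶ N') [Epi f] {U : Cᵒᵖ} (y : N'.val.obj U) :
    ∃ S ∈ J U.unop, ∀ ⦃V : C⦄ (i : V ⟶ U.unop), S i → ∃ x, ev f (op V) x = res N' i.op y := by
  let q : N'.val ⟶ cokernel f.val := cokernel.π f.val
  let L := PresheafOfModules.sheafification.{u} (𝟙 R.obj)
  let adj := PresheafOfModules.sheafificationAdjunction.{u} (𝟙 R.obj)
  let e := asIso adj.counit
  have hf : Epi (L.map f.val) := by
    have h : Epi (((SheafOfModules.forget R ⋙ PresheafOfModules.restrictScalars (𝟙 R.obj)) ⋙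
        L).map f) := by
      rw [← NatIso.naturality_2 e f]
      have : Epi ((𝟭 (SheafOfModules R)).map f) := by assumption
      infer_instance
    exact h
  have hq : L.map q = 0 := by
    rw [← cancel_epi (L.map f.val), ← L.map_comp, cokernel.condition, L.map_zero, comp_zero]
  have hq' : (PresheafOfModules.toPresheaf R.obj).map q ≫
      CategoryTheory.toSheafify J (cokernel f.val).presheaf = 0 := by
    have h := CategoryTheory.toSheafify_naturality J ((PresheafOfModules.toPresheaf R.obj).map q)
    refine h.trans ?_
    have h3 : sheafifyMap J ((PresheafOfModules.toPresheaf R.obj).map q) =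
      (PresheafOfModules.toPresheaf R.obj).map (L.map q).val := rfl
    rw [h3, hq]
    ext; rfl
  let T : (cokernel f.val).presheaf ⟶ _ := CategoryTheory.toSheafify J (cokernel f.val).presheaf
  have hq2 : T.app U (q.app U y) = T.app U (0 : (cokernel f.val).obj U) :=
    (ConcreteCategory.congr_hom (congr_app hq' U) y).trans (map_zero (T.app U).hom).symm
  refine ⟨_, Presheaf.equalizerSieve_mem J T (X := U) (q.app U y) 0 hq2, fun V i hi => ?_⟩
  have hi' : q.app (op V) (res N' i.op y) = 0 := by
    refine (PresheafOfModules.naturality_apply q i.op y).trans (Eq.trans hi ?_)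
    exact map_zero ((cokernel f.val).presheaf.map i.op).hom
  have hex : (ShortComplex.mk f.val q (cokernel.condition _)).Exact :=
    ShortComplex.exact_cokernel _
  have := hex.map (PresheafOfModules.evaluation R.obj (op V))
  rw [ShortComplex.moduleCat_exact_iff] at this
  exact this _ hi'

lemma exists_lift_of_kernel {K : SheafOfModules.{u} R} (k : K ⟶ N) (f : N ⟶ N') [Mono k]
    (w : k ≫ f = 0) (h : (ShortComplex.mk k f w).Exact) {U : Cᵒᵖ} (x : N.val.obj U)
    (hx : ev f U x = 0) : ∃ y, ev k U y = x := by
  have := h.map_of_mono_of_preservesKernel (SheafOfModules.evaluation R U) inferInstance inferInstance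
  rw [ShortComplex.moduleCat_exact_iff] at this
  exact this x hx

lemma exact_of_ev (f : N ⟶ N') (g : N' ⟶ N'') (w : f ≫ g = 0)
    (h : ∀ U, Function.Injective (ev f U))
    (h' : ∀ (U : Cᵒᵖ) (n : N'.val.obj U), ev g U n = 0 → ∃ y, ev f U y = n) :
    (ShortComplex.mk f g w).Exact :=
  have := mono_of_ev_injective f h
  ShortComplex.exact_of_f_is_kernel _ (KernelFork.IsLimit.ofι' f w fun k hk =>
    have hl := exists_factor f h k fun U n => h' U _ (by
      rw [← ev_comp, hk, ev_zero])
    ⟨hl.choose, hl.choose_spec⟩)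

end Sections

/-- A morphism of sheaves of modules `N ⊗ M ⟶ P`, given through the universal property of the
tensor product: a map `N × M ⟶ P` of sheaves that is bilinear over the sheaf of (commutative)
rings `R`. -/
@[ext]
structure BilinHom (N M P : SheafOfModules.{u} R) where
  /-- the biadditive map on sections over `U` -/
  app (U : Cᵒᵖ) : N.val.obj U →+ M.val.obj U →+ P.val.obj U
  smul_left (U : Cᵒᵖ) (r : R.obj.obj U) (n : N.val.obj U) (m : M.val.obj U) :
    app U (r • n) m = r • app U n m
  smul_right (U : Cᵒᵖ) (r : R.obj.obj U) (n : N.val.obj U) (m : M.val.obj U) :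
    app U n (r • m) = r • app U n m
  naturality {U V : Cᵒᵖ} (i : U ⟶ V) (n : N.val.obj U) (m : M.val.obj U) :
    res P i (app U n m) = app V (res N i n) (res M i m)

namespace BilinHom

variable {N N' N'' M P P' P'' : SheafOfModules.{u} R}

lemma ext_app {B B' : BilinHom N M P}
    (h : ∀ (U : Cᵒᵖ) (n : N.val.obj U) (m : M.val.obj U), B.app U n m = B'.app U n m) : B = B' := by
  ext U n m
  exact h U n m

/-- Precomposition in the first variable, `B ∘ (f ⊗ id)`. -/
noncomputable def precomp (f : N ⟶ N') (B : BilinHom N' M P) : BilinHom N M P where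
  app U := (B.app U).comp (ev f U).toAddMonoidHom
  smul_left U r n m := by simp [B.smul_left]
  smul_right U r n m := by simp [B.smul_right]
  naturality i n m := by simp [B.naturality, ev_res]

/-- Postcomposition, `g ∘ B`. -/
noncomputable def postcomp (B : BilinHom N M P) (g : P ⟶ P') : BilinHom N M P' where
  app U :=
    { toFun := fun n => (ev g U).toAddMonoidHom.comp (B.app U n)
      map_zero' := by ext; simp
      map_add' := fun a b => by ext; simp }
  smul_left U r n m := by simp [B.smul_left]
  smul_right U r n m := by simp [B.smul_right]
  naturality i n m := by simp [← B.naturality, ev_res]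

@[simp] lemma precomp_app (f : N ⟶ N') (B : BilinHom N' M P) (U : Cᵒᵖ) (n : N.val.obj U)
    (m : M.val.obj U) : (precomp f B).app U n m = B.app U (ev f U n) m := rfl

@[simp] lemma postcomp_app (B : BilinHom N M P) (g : P ⟶ P') (U : Cᵒᵖ) (n : N.val.obj U)
    (m : M.val.obj U) : (postcomp B g).app U n m = ev g U (B.app U n m) := rfl

instance : Zero (BilinHom N M P) where
  zero :=
    { app := fun U => 0
      smul_left := by intros; simp
      smul_right := by intros; simp
      naturality := by intros; simp }

instance : Add (BilinHom N M P) where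
  add B B' :=
    { app := fun U => B.app U + B'.app U
      smul_left := by intros; simp [B.smul_left, B'.smul_left]
      smul_right := by intros; simp [B.smul_right, B'.smul_right]
      naturality := by intros; simp [B.naturality, B'.naturality] }

@[simp] lemma zero_app (U : Cᵒᵖ) (n : N.val.obj U) (m : M.val.obj U) :
    (0 : BilinHom N M P).app U n m = 0 := rfl

@[simp] lemma add_app (B B' : BilinHom N M P) (U : Cᵒᵖ) (n : N.val.obj U) (m : M.val.obj U) :
    (B + B').app U n m = B.app U n m + B'.app U n m := rfl

lemma postcomp_injective (g : P ⟶ P') [Mono g] {B B' : BilinHom N M P}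
    (h : postcomp B g = postcomp B' g) : B = B' := by
  refine ext_app fun U n m => ev_injective_of_mono g U ?_
  exact congr($(h).app U n m)

variable [HasSheafify J AddCommGrpCat.{u}] [J.WEqualsLocallyBijective AddCommGrpCat.{u}]

lemma precomp_injective (f : N ⟶ N') [Epi f] {B B' : BilinHom N' M P}
    (h : precomp f B = precomp f B') : B = B' := by
  refine ext_app fun U n m => ?_
  obtain ⟨S, hS, hl⟩ := exists_local_lift_of_epi f n
  refine sep P S hS fun V i hi => ?_
  obtain ⟨x, hx⟩ := hl i hi
  rw [naturality, naturality, ← hx]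
  exact congr($(h).app _ x _)

lemma exists_lift {K : SheafOfModules.{u} R} (k : K ⟶ P) (g : P ⟶ P') [Mono k] (w : k ≫ g = 0)
    (h : (ShortComplex.mk k g w).Exact) (B : BilinHom N M P) (hB : postcomp B g = 0) :
    ∃ B' : BilinHom N M K, postcomp B' k = B := by
  have hl (U : Cᵒᵖ) (n : N.val.obj U) (m : M.val.obj U) : ∃ y, ev k U y = B.app U n m :=
    exists_lift_of_kernel k g w h _ congr($(hB).app U n m)
  choose b hb using hl
  refine ⟨{ app := fun U => AddMonoidHom.mk' (fun n => AddMonoidHom.mk' (b U n) ?_) ?_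
            smul_left := ?_
            smul_right := ?_
            naturality := ?_ }, ext_app hb⟩
  · intro m m'
    apply ev_injective_of_mono k
    simp [hb]
  · intro n n'
    ext m
    apply ev_injective_of_mono k
    simp [hb]
  · intro U r n m
    apply ev_injective_of_mono k
    simp [hb, B.smul_left]
  · intro U r n m
    apply ev_injective_of_mono k
    simp [hb, B.smul_right]
  · intro U V i n m
    apply ev_injective_of_mono k
    simp [hb, ev_res, B.naturality]

lemma app_eq_of_ev_eq {Q : SheafOfModules.{u} R} (f : N ⟶ N') (c : N' ⟶ Q) (w : f ≫ c = 0)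
    (h : (ShortComplex.mk f c w).Exact) (B : BilinHom N' M P) (hB : precomp f B = 0)
    (U : Cᵒᵖ) (n n' : N'.val.obj U) (m : M.val.obj U) (hn : ev c U n = ev c U n') :
    B.app U n m = B.app U n' m := by
  have hz (n : N'.val.obj U) (hn : ev c U n = 0) : B.app U n m = 0 := by
    obtain ⟨k, rfl⟩ := exists_lift_of_kernel (kernel.ι c) c (kernel.condition c)
      (ShortComplex.exact_kernel c) n hn
    have := (ShortComplex.mk f c w).exact_iff_epi_kernel_lift.1 h
    obtain ⟨S, hS, hl⟩ := exists_local_lift_of_epi (kernel.lift c f w) k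
    refine sep P S hS fun V i hi => ?_
    obtain ⟨x, hx⟩ := hl i hi
    rw [naturality, ← ev_res, ← hx, ← ev_comp, kernel.lift_ι, map_zero]
    exact congr($(hB).app _ x _)
  have := hz (n - n') (by rw [map_sub, hn, sub_self])
  rwa [map_sub, AddMonoidHom.sub_apply, sub_eq_zero] at this

lemma exists_desc_app {Q : SheafOfModules.{u} R} (c : N' ⟶ Q) [Epi c] (B : BilinHom N' M P)
    (hz : ∀ (U : Cᵒᵖ) (n n' : N'.val.obj U) (m : M.val.obj U), ev c U n = ev c U n' →
      B.app U n m = B.app U n' m) (U : Cᵒᵖ) (q : Q.val.obj U) (m : M.val.obj U) :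
    ∃ y : P.val.obj U, ∀ ⦃V : Cᵒᵖ⦄ (i : U ⟶ V) (n : N'.val.obj V), ev c V n = res Q i q →
      res P i y = B.app V n (res M i m) := by
  obtain ⟨S, hS, hl⟩ := exists_local_lift_of_epi c q
  choose x hx using hl
  obtain ⟨y, hy⟩ := glue P S hS (fun V i hi => B.app _ (x i hi) (res M i.op m)) (by
    intro V W i j hi
    rw [naturality, ← res_comp, ← op_comp]
    refine hz _ _ _ _ ?_
    rw [ev_res, hx, hx, ← res_comp, ← op_comp])
  refine ⟨y, fun V i n hn => ?_⟩
  refine sep P (S.pullback i.unop) (J.pullback_stable i.unop hS) fun W j hj => ?_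
  have hj' : S (j ≫ i.unop) := hj
  have h1 := hy (j ≫ i.unop) hj'
  rw [op_comp, res_comp, Quiver.Hom.op_unop] at h1
  rw [h1, naturality, ← res_comp]
  refine hz _ _ _ _ ?_
  rw [hx, ev_res, hn, op_comp, res_comp, Quiver.Hom.op_unop]

lemma exists_desc {Q : SheafOfModules.{u} R} (f : N ⟶ N') (c : N' ⟶ Q) [Epi c] (w : f ≫ c = 0)
    (h : (ShortComplex.mk f c w).Exact) (B : BilinHom N' M P) (hB : precomp f B = 0) :
    ∃ B' : BilinHom Q M P, precomp c B' = B := by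
  have hy := exists_desc_app c B (app_eq_of_ev_eq f c w h B hB)
  choose b hb using hy
  have hloc (U : Cᵒᵖ) (q : Q.val.obj U) (m : M.val.obj U) (y : P.val.obj U) (S : Sieve U.unop)
      (hS : S ∈ J U.unop) (hy : ∀ ⦃V : C⦄ (i : V ⟶ U.unop), S i → ∃ n : N'.val.obj (op V),
        ev c _ n = res Q i.op q ∧ res P i.op y = B.app _ n (res M i.op m)) : b U q m = y := by
    refine sep P S hS fun V i hi => ?_
    obtain ⟨n, hn, hn'⟩ := hy i hi
    rw [hn', hb U q m i.op n hn]
  have hadd_right (U : Cᵒᵖ) (n : Q.val.obj U) (m m' : M.val.obj U) :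
      b U n (m + m') = b U n m + b U n m' := by
    obtain ⟨S, hS, hl⟩ := exists_local_lift_of_epi c n
    refine hloc _ _ _ _ S hS fun V i hi => ?_
    obtain ⟨x, hx⟩ := hl i hi
    refine ⟨x, hx, ?_⟩
    rw [map_add, map_add, map_add, hb U n m _ x hx, hb U n m' _ x hx]
  have hadd_left (U : Cᵒᵖ) (n n' : Q.val.obj U) (m : M.val.obj U) :
      b U (n + n') m = b U n m + b U n' m := by
    obtain ⟨S, hS, hl⟩ := exists_local_lift_of_epi c n
    obtain ⟨S', hS', hl'⟩ := exists_local_lift_of_epi c n'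
    refine hloc _ _ _ _ (S ⊓ S') (J.intersection_covering hS hS') fun V i hi => ?_
    obtain ⟨x, hx⟩ := hl i hi.1
    obtain ⟨x', hx'⟩ := hl' i hi.2
    refine ⟨x + x', by rw [map_add, map_add, hx, hx'], ?_⟩
    rw [map_add, map_add, hb U n m _ x hx, hb U n' m _ x' hx', AddMonoidHom.add_apply]
  have hsmul_left (U : Cᵒᵖ) (r : R.obj.obj U) (n : Q.val.obj U) (m : M.val.obj U) :
      b U (r • n) m = r • b U n m := by
    obtain ⟨S, hS, hl⟩ := exists_local_lift_of_epi c n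
    refine hloc _ _ _ _ S hS fun V i hi => ?_
    obtain ⟨x, hx⟩ := hl i hi
    refine ⟨R.obj.map i.op r • x, by rw [map_smul, res_smul, hx], ?_⟩
    rw [res_smul, B.smul_left, hb U n m _ x hx]
  have hsmul_right (U : Cᵒᵖ) (r : R.obj.obj U) (n : Q.val.obj U) (m : M.val.obj U) :
      b U n (r • m) = r • b U n m := by
    obtain ⟨S, hS, hl⟩ := exists_local_lift_of_epi c n
    refine hloc _ _ _ _ S hS fun V i hi => ?_
    obtain ⟨x, hx⟩ := hl i hi
    refine ⟨x, hx, ?_⟩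
    rw [res_smul, res_smul, B.smul_right, hb U n m _ x hx]
  have hnat {U V : Cᵒᵖ} (i : U ⟶ V) (n : Q.val.obj U) (m : M.val.obj U) :
      res P i (b U n m) = b V (res Q i n) (res M i m) := by
    obtain ⟨S, hS, hl⟩ := exists_local_lift_of_epi c (res Q i n)
    refine (hloc _ _ _ _ S hS fun W j hj => ?_).symm
    obtain ⟨x, hx⟩ := hl j hj
    refine ⟨x, hx, ?_⟩
    rw [← res_comp] at hx ⊢
    rw [← res_comp]
    exact hb _ _ _ _ _ hx
  have hfac (U : Cᵒᵖ) (n : N'.val.obj U) (m : M.val.obj U) : b U (ev c U n) m = B.app U n m := by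
    refine hloc _ _ _ _ ⊤ (J.top_mem _) fun V i _ => ⟨res N' i.op n, ev_res _ _ _, ?_⟩
    rw [naturality]
  exact ⟨{ app := fun U => AddMonoidHom.mk' (fun n => AddMonoidHom.mk' (b U n) (hadd_right U n))
            fun n n' => AddMonoidHom.ext (hadd_left U n n')
           smul_left := hsmul_left
           smul_right := hsmul_right
           naturality := hnat }, ext_app hfac⟩

end BilinHom
end Bilinear

section QuiverSheaf

variable {C : Type u} [Category.{u} C] {J : GrothendieckTopology C} {R : Sheaf J RingCat.{u}}
  {Q₀ : Type w₀} {Q₁ : Type w₁}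

/-- For a quiver with vertices `Q₀`, arrows `Q₁`, source `s` and target `t`, and sheaves of modules
`M a` indexed by the arrows: an `M`-twisted quiver sheaf, i.e. a sheaf of modules `E i` for each
vertex and a morphism `E (s a) ⊗ M a ⟶ E (t a)` for each arrow. -/
structure QuiverSheaf (s t : Q₁ → Q₀) (M : Q₁ → SheafOfModules.{u} R) where
  /-- the sheaf of modules at a vertex -/
  obj : Q₀ → SheafOfModules.{u} R
  /-- the structure morphism of an arrow -/
  map (a : Q₁) : BilinHom (obj (s a)) (M a) (obj (t a))

namespace QuiverSheaf

variable {s t : Q₁ → Q₀} {M : Q₁ → SheafOfModules.{u} R}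

/-- A morphism of twisted quiver sheaves: morphisms `f i` with
`f (t a) ∘ φ a = ψ a ∘ (f (s a) ⊗ id)` for every arrow `a`. -/
@[ext]
structure Hom (X Y : QuiverSheaf s t M) where
  /-- the morphism at a vertex -/
  app (i : Q₀) : X.obj i ⟶ Y.obj i
  comm (a : Q₁) : (X.map a).postcomp (app (t a)) = (Y.map a).precomp (app (s a))

instance : Category.{max u w₀} (QuiverSheaf s t M) where
  Hom := Hom
  id X := { app := fun i => 𝟙 (X.obj i), comm := fun a => rfl }
  comp f g :=
    { app := fun i => f.app i ≫ g.app i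
      comm := fun a => BilinHom.ext_app fun U n m =>
        (congrArg (ev (g.app (t a)) U) congr($(f.comm a).app U n m)).trans
          congr($(g.comm a).app U (ev (f.app (s a)) U n) m) }

variable {X Y Z : QuiverSheaf s t M}

@[ext]
lemma hom_ext {f g : X ⟶ Y} (h : ∀ i, f.app i = g.app i) : f = g := Hom.ext (funext h)

@[simp] lemma id_app (X : QuiverSheaf s t M) (i : Q₀) : Hom.app (𝟙 X) i = 𝟙 (X.obj i) := rfl

@[simp] lemma comp_app (f : X ⟶ Y) (g : Y ⟶ Z) (i : Q₀) : (f ≫ g).app i = f.app i ≫ g.app i := rfl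

instance : Zero (X ⟶ Y) where
  zero := { app := fun i => 0, comm := fun a => BilinHom.ext_app fun U n m => by simp }

instance : Add (X ⟶ Y) where
  add f g :=
    { app := fun i => f.app i + g.app i
      comm := fun a => BilinHom.ext_app fun U n m => by
        simpa using congr($(f.comm a).app U n m + $(g.comm a).app U n m) }

instance : Neg (X ⟶ Y) where
  neg f :=
    { app := fun i => -f.app i
      comm := fun a => BilinHom.ext_app fun U n m => by
        have h : ∀ {N N' : SheafOfModules.{u} R} (k : N ⟶ N') (n : N.val.obj U),
          ev (-k) U n = - ev k U n := fun _ _ => rfl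
        simpa [h] using congr(-$(f.comm a).app U n m) }

@[simp] lemma zero_app (i : Q₀) : (0 : X ⟶ Y).app i = 0 := rfl
@[simp] lemma add_app (f g : X ⟶ Y) (i : Q₀) : (f + g).app i = f.app i + g.app i := rfl
@[simp] lemma neg_app (f : X ⟶ Y) (i : Q₀) : (-f).app i = -f.app i := rfl

instance : AddCommGroup (X ⟶ Y) where
  add_assoc f g h := by ext1 i; simp [add_assoc]
  zero_add f := by ext1 i; simp
  add_zero f := by ext1 i; simp
  neg_add_cancel f := by ext1 i; simp
  add_comm f g := by ext1 i; simp [add_comm]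
  nsmul := nsmulRec
  zsmul := zsmulRec

instance : Preadditive (QuiverSheaf s t M) where
  add_comp _ _ _ _ _ _ := by ext1 i; simp
  comp_add _ _ _ _ _ _ := by ext1 i; simp

lemma mono_of_app (f : X ⟶ Y) (h : ∀ i, Mono (f.app i)) : Mono f where
  right_cancellation g k w := by
    ext1 i
    rw [← cancel_mono (f.app i)]
    exact congr(($w).app i)

lemma epi_of_app (f : X ⟶ Y) (h : ∀ i, Epi (f.app i)) : Epi f where
  left_cancellation g k w := by
    ext1 i
    rw [← cancel_epi (f.app i)]
    exact congr(($w).app i)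

/-- A family of morphisms that becomes a morphism after composition with a monomorphism. -/
def homOfMono (f : X ⟶ Y) [∀ i, Mono (f.app i)] (k : Z ⟶ Y) (l : ∀ i, Z.obj i ⟶ X.obj i)
    (hl : ∀ i, l i ≫ f.app i = k.app i) : Z ⟶ X where
  app := l
  comm a := by
    apply BilinHom.postcomp_injective (f.app (t a))
    refine BilinHom.ext_app fun U n m => ?_
    have h1 := congr($(k.comm a).app U n m)
    have h2 := congr($(f.comm a).app U (ev (l (s a)) U n) m)
    simp only [← hl, BilinHom.postcomp_app, BilinHom.precomp_app, ev_comp] at h1 h2 ⊢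
    rw [h1, h2]

variable [HasSheafify J AddCommGrpCat.{u}] [J.WEqualsLocallyBijective AddCommGrpCat.{u}]

/-- A family of morphisms that becomes a morphism after precomposition with an epimorphism. -/
def homOfEpi (f : X ⟶ Y) [∀ i, Epi (f.app i)] (k : X ⟶ Z) (l : ∀ i, Y.obj i ⟶ Z.obj i)
    (hl : ∀ i, f.app i ≫ l i = k.app i) : Y ⟶ Z where
  app := l
  comm a := by
    apply BilinHom.precomp_injective (f.app (s a))
    refine BilinHom.ext_app fun U n m => ?_
    have h1 := congr($(k.comm a).app U n m)
    have h2 := congr(ev (l (t a)) U ($(f.comm a).app U n m))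
    simp only [← hl, BilinHom.postcomp_app, BilinHom.precomp_app, ev_comp] at h1 h2 ⊢
    rw [← h2, h1]

lemma exists_kernel_map (f : X ⟶ Y) (a : Q₁) :
    ∃ B : BilinHom (kernel (f.app (s a))) (M a) (kernel (f.app (t a))),
      B.postcomp (kernel.ι (f.app (t a))) = (X.map a).precomp (kernel.ι (f.app (s a))) := by
  refine BilinHom.exists_lift _ (f.app (t a)) (kernel.condition _) (ShortComplex.exact_kernel _) _ ?_
  refine BilinHom.ext_app fun U n m => ?_
  refine (congr($(f.comm a).app U (ev (kernel.ι (f.app (s a))) U n) m)).trans ?_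
  simp [← ev_comp]

lemma exists_cokernel_map (f : X ⟶ Y) (a : Q₁) :
    ∃ B : BilinHom (cokernel (f.app (s a))) (M a) (cokernel (f.app (t a))),
      B.precomp (cokernel.π (f.app (s a))) = (Y.map a).postcomp (cokernel.π (f.app (t a))) := by
  refine BilinHom.exists_desc (f.app (s a)) _ (cokernel.condition _)
    (ShortComplex.exact_cokernel _) _ ?_
  refine BilinHom.ext_app fun U n m => ?_
  refine (congr(ev (cokernel.π (f.app (t a))) U ($(f.comm a).app U n m))).symm.trans ?_
  simp [← ev_comp]

/-- The kernel, computed vertex by vertex. -/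
noncomputable def ker (f : X ⟶ Y) : QuiverSheaf s t M where
  obj i := kernel (f.app i)
  map a := (exists_kernel_map f a).choose

/-- The inclusion of the kernel. -/
noncomputable def kerι (f : X ⟶ Y) : ker f ⟶ X where
  app i := kernel.ι (f.app i)
  comm a := (exists_kernel_map f a).choose_spec

/-- The cokernel, computed vertex by vertex. -/
noncomputable def coker (f : X ⟶ Y) : QuiverSheaf s t M where
  obj i := cokernel (f.app i)
  map a := (exists_cokernel_map f a).choose

/-- The projection onto the cokernel. -/
noncomputable def cokerπ (f : X ⟶ Y) : Y ⟶ coker f where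
  app i := cokernel.π (f.app i)
  comm a := (exists_cokernel_map f a).choose_spec.symm

instance (f : X ⟶ Y) (i : Q₀) : Mono ((kerι f).app i) := inferInstanceAs (Mono (kernel.ι _))
instance (f : X ⟶ Y) (i : Q₀) : Epi ((cokerπ f).app i) := inferInstanceAs (Epi (cokernel.π _))

lemma kerι_comp (f : X ⟶ Y) : kerι f ≫ f = 0 := by
  ext1 i
  exact kernel.condition (f.app i)

lemma comp_cokerπ (f : X ⟶ Y) : f ≫ cokerπ f = 0 := by
  ext1 i
  exact cokernel.condition (f.app i)

/-- A morphism that is a kernel at every vertex is a kernel. -/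
noncomputable def isLimitOfApp (k : X ⟶ Y) (f : Y ⟶ Z) (w : k ≫ f = 0)
    (hm : ∀ i, Mono (k.app i))
    (h : ∀ i, (ShortComplex.mk (k.app i) (f.app i) congr(($w).app i)).Exact) :
    IsLimit (KernelFork.ofι k w) :=
  have := mono_of_app k hm
  KernelFork.IsLimit.ofι' k w fun {W} g hg =>
    ⟨homOfMono k g (fun i => haveI := hm i; (h i).lift (g.app i) congr(($hg).app i))
      (fun i => haveI := hm i; (h i).lift_f (g.app i) _), by
        ext1 i
        have := hm i
        exact (h i).lift_f (g.app i) _⟩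

/-- A morphism that is a cokernel at every vertex is a cokernel. -/
noncomputable def isColimitOfApp (k : X ⟶ Y) (f : Y ⟶ Z) (w : k ≫ f = 0)
    (hm : ∀ i, Epi (f.app i))
    (h : ∀ i, (ShortComplex.mk (k.app i) (f.app i) congr(($w).app i)).Exact) :
    IsColimit (CokernelCofork.ofπ f w) :=
  have := epi_of_app f hm
  CokernelCofork.IsColimit.ofπ' f w fun {W} g hg =>
    ⟨homOfEpi f g (fun i => haveI := hm i; (h i).desc (g.app i) congr(($hg).app i))
      (fun i => haveI := hm i; (h i).g_desc (g.app i) _), by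
        ext1 i
        have := hm i
        exact (h i).g_desc (g.app i) _⟩

instance : HasKernels (QuiverSheaf s t M) where
  has_limit f := ⟨⟨_, isLimitOfApp (kerι f) f (kerι_comp f) (fun _ => inferInstance)
    (fun _ => ShortComplex.exact_kernel _)⟩⟩

instance : HasCokernels (QuiverSheaf s t M) where
  has_colimit f := ⟨⟨_, isColimitOfApp f (cokerπ f) (comp_cokerπ f) (fun _ => inferInstance)
    (fun _ => ShortComplex.exact_cokernel _)⟩⟩

lemma app_mono (f : X ⟶ Y) [Mono f] (i : Q₀) : Mono (f.app i) := by
  have h : kerι f = 0 := zero_of_comp_mono f (kerι_comp f)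
  exact Preadditive.mono_of_kernel_zero congr(($h).app i)

lemma app_epi (f : X ⟶ Y) [Epi f] (i : Q₀) : Epi (f.app i) := by
  have h : cokerπ f = 0 := zero_of_epi_comp f (comp_cokerπ f)
  exact Preadditive.epi_of_cokernel_zero congr(($h).app i)

instance : IsNormalMonoCategory (QuiverSheaf s t M) where
  normalMonoOfMono f _ := ⟨⟨_, cokerπ f, comp_cokerπ f,
    isLimitOfApp f (cokerπ f) _ (app_mono f) (fun _ => ShortComplex.exact_cokernel _)⟩⟩

instance : IsNormalEpiCategory (QuiverSheaf s t M) where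
  normalEpiOfEpi f _ := ⟨⟨_, kerι f, kerι_comp f,
    isColimitOfApp (kerι f) f _ (app_epi f) (fun _ => ShortComplex.exact_kernel _)⟩⟩

/-- The zero object. -/
noncomputable def zeroObj : QuiverSheaf s t M where
  obj _ := 0
  map _ := 0

lemma isZero_zeroObj : IsZero (zeroObj : QuiverSheaf s t M) := by
  rw [IsZero.iff_id_eq_zero]
  ext1 i
  exact (isZero_zero (SheafOfModules.{u} R)).eq_of_src (𝟙 0) 0

instance : HasZeroObject (QuiverSheaf s t M) := ⟨_, isZero_zeroObj⟩

/-- The direct sum of two twisted quiver sheaves. -/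
noncomputable def sum (X Y : QuiverSheaf s t M) : QuiverSheaf s t M where
  obj i := X.obj i ⊞ Y.obj i
  map a := ((X.map a).precomp biprod.fst).postcomp biprod.inl +
    ((Y.map a).precomp biprod.snd).postcomp biprod.inr

/-- The direct sum is a biproduct. -/
noncomputable def sumBicone (X Y : QuiverSheaf s t M) : BinaryBicone X Y where
  pt := sum X Y
  fst :=
    { app := fun i => biprod.fst
      comm := fun a => BilinHom.ext_app fun U n m => by
        change ev biprod.fst U (ev biprod.inl U ((X.map a).app U (ev biprod.fst U n) m) +
          ev biprod.inr U ((Y.map a).app U (ev biprod.snd U n) m)) =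
            (X.map a).app U (ev biprod.fst U n) m
        rw [map_add, ← ev_comp, ← ev_comp, biprod.inl_fst, biprod.inr_fst]
        simp }
  snd :=
    { app := fun i => biprod.snd
      comm := fun a => BilinHom.ext_app fun U n m => by
        change ev biprod.snd U (ev biprod.inl U ((X.map a).app U (ev biprod.fst U n) m) +
          ev biprod.inr U ((Y.map a).app U (ev biprod.snd U n) m)) =
            (Y.map a).app U (ev biprod.snd U n) m
        rw [map_add, ← ev_comp, ← ev_comp, biprod.inl_snd, biprod.inr_snd]
        simp }
  inl :=
    { app := fun i => biprod.inl
      comm := fun a => BilinHom.ext_app fun U n m => by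
        change ev biprod.inl U ((X.map a).app U n m) =
          ev biprod.inl U ((X.map a).app U (ev biprod.fst U (ev biprod.inl U n)) m) +
            ev biprod.inr U ((Y.map a).app U (ev biprod.snd U (ev biprod.inl U n)) m)
        rw [← ev_comp, ← ev_comp, biprod.inl_fst, biprod.inl_snd]
        simp }
  inr :=
    { app := fun i => biprod.inr
      comm := fun a => BilinHom.ext_app fun U n m => by
        change ev biprod.inr U ((Y.map a).app U n m) =
          ev biprod.inl U ((X.map a).app U (ev biprod.fst U (ev biprod.inr U n)) m) +
            ev biprod.inr U ((Y.map a).app U (ev biprod.snd U (ev biprod.inr U n)) m)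
        rw [← ev_comp, ← ev_comp, biprod.inr_fst, biprod.inr_snd]
        simp }
  inl_fst := by ext1 i; exact biprod.inl_fst
  inl_snd := by ext1 i; exact biprod.inl_snd
  inr_fst := by ext1 i; exact biprod.inr_fst
  inr_snd := by ext1 i; exact biprod.inr_snd

instance : HasBinaryBiproducts (QuiverSheaf s t M) where
  has_binary_biproduct X Y :=
    hasBinaryBiproduct_of_total (sumBicone X Y) (by ext1 i; exact biprod.total)

instance : HasFiniteProducts (QuiverSheaf s t M) :=
  hasFiniteProducts_of_has_binary_and_terminal

noncomputable instance : Abelian (QuiverSheaf s t M) where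

instance : HasExt.{max (u + 1) w₀ w₁} (QuiverSheaf s t M) := HasExt.standard _

end QuiverSheaf

end QuiverSheaf

section Manifold

variable {EM : Type u} [NormedAddCommGroup EM] [NormedSpace ℝ EM] {H : Type v} [TopologicalSpace H]
  (I : ModelWithCorners ℝ EM H) {X : Type u} [TopologicalSpace X] [ChartedSpace H X]

/-- Smooth real functions on an open subset. -/
abbrev SmoothFun (U : Opens X) : Type u := C^∞⟮I, U; 𝓘(ℝ, ℝ), ℝ⟯

/-- Restriction of smooth functions. -/
noncomputable abbrev SmoothFun.res {U V : Opens X} (i : V ≤ U) : SmoothFun I U →+* SmoothFun I V :=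
  ContMDiffMap.restrictRingHom I 𝓘(ℝ, ℝ) ℝ i

/-- Restriction of (arbitrary) sections of a family. -/
def restr {T : X → Type u} {U V : Opens X} (i : V ≤ U) (f : ∀ x : U, T x) : ∀ x : V, T x :=
  fun x => f ⟨x, i x.2⟩

/-- Being smooth is a local property of maps from open subsets of the manifold. -/
lemma contMDiff_of_locally {E' : Type*} [NormedAddCommGroup E'] [NormedSpace ℝ E'] {H' : Type*}
    [TopologicalSpace H'] {I' : ModelWithCorners ℝ E' H'} {N : Type*} [TopologicalSpace N]
    [ChartedSpace H' N] {U : Opens X} (f : U → N)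
    (h : ∀ x : U, ∃ (V : Opens X) (_ : x.1 ∈ V) (i : V ≤ U),
      ContMDiff I I' ∞ fun y : V => f ⟨y, i y.2⟩) : ContMDiff I I' ∞ f := by
  intro x
  obtain ⟨V, hx, i, hV⟩ := h x
  let g : X → N := Function.extend Subtype.val f fun _ => f x
  have hg : ∀ y : U, g y = f y := fun y => Subtype.val_injective.extend_apply f _ y
  have h1 : (fun y : U => g y) = f := funext hg
  have h2 : (fun y : V => g y) = fun y : V => f ⟨y, i y.2⟩ := funext fun y => hg ⟨y, i y.2⟩
  rw [← h2] at hV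
  rw [← h1]
  exact contMDiffAt_subtype_iff.2 ((contMDiffAt_subtype_iff (U := V) (x := ⟨x, hx⟩)).1 (hV _))

/-- A presheaf of sections that is cut out by a local condition is a sheaf. -/
lemma isSheaf_of_local {T : X → Type u} (P : ∀ U : Opens X, (∀ x : U, T x) → Prop)
    (hres : ∀ {U V : Opens X} (i : V ≤ U) (f : ∀ x : U, T x), P U f → P V (restr i f))
    (hloc : ∀ (U : Opens X) (f : ∀ x : U, T x),
      (∀ x : U, ∃ (V : Opens X) (_ : x.1 ∈ V) (i : V ≤ U), P V (restr i f)) → P U f)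
    (F : (Opens X)ᵒᵖ ⥤ Type u)
    (hF : F = TopCat.subpresheafToTypes (X := TopCat.of X) (T := T)
      ⟨fun {U} => P U, fun i f hf => hres i.le f hf⟩) :
    Presheaf.IsSheaf (Opens.grothendieckTopology X) F := by
  rw [hF]
  exact TopCat.subpresheafToTypes.isSheaf (X := TopCat.of X) (T := T)
    ⟨⟨fun {U} => P U, fun i f hf => hres i.le f hf⟩, fun f h => hloc _ f fun x => by
      obtain ⟨V, hx, i, h⟩ := h x
      exact ⟨V, hx, i.le, h⟩⟩

variable (X) in
/-- The presheaf of smooth functions. -/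
noncomputable def smoothRingPresheaf : (Opens X)ᵒᵖ ⥤ RingCat.{u} where
  obj U := RingCat.of (SmoothFun I U.unop)
  map i := RingCat.ofHom (SmoothFun.res I i.unop.le)
  map_id _ := rfl
  map_comp _ _ := rfl

variable (X) in
/-- The sheaf of smooth functions. -/
noncomputable def smoothRingSheaf : Sheaf (Opens.grothendieckTopology X) RingCat.{u} where
  obj := smoothRingPresheaf I X
  property := by
    rw [Presheaf.isSheaf_iff_isSheaf_forget _ _ (forget RingCat)]
    have := isSheaf_of_local (X := X) (T := fun _ => ULift.{u} ℝ)
      (fun U f => ContMDiff I 𝓘(ℝ, ℝ) ∞ fun x => (f x).down)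
      (fun i f hf => hf.comp (contMDiff_inclusion i))
      (fun U f h => contMDiff_of_locally I _ h) _ rfl
    refine (Presheaf.isSheaf_of_iso_iff ?_).1 this
    exact NatIso.ofComponents (fun U => Equiv.toIso
      { toFun := fun f => ⟨fun x => (f.1 x).down, f.2⟩
        invFun := fun f => ⟨fun x => ⟨f.1 x⟩, f.2⟩
        left_inv := fun _ => rfl
        right_inv := fun _ => rfl }) (fun _ => rfl)

section
variable (T : X → Type u) [∀ x, AddCommGroup (T x)] (S : ∀ U : Opens X, AddSubgroup (∀ x : U, T x))
  (hres : ∀ {U V : Opens X} (i : V ≤ U) (f : ∀ x : U, T x), f ∈ S U → restr i f ∈ S V)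

/-- The presheaf of abelian groups given by subgroups of the groups of sections of a family. -/
noncomputable def abPresheaf : (Opens X)ᵒᵖ ⥤ AddCommGrpCat.{u} where
  obj U := AddCommGrpCat.of (S U.unop)
  map i := AddCommGrpCat.ofHom
    { toFun := fun f => ⟨restr i.unop.le f.1, hres i.unop.le f.1 f.2⟩
      map_zero' := rfl
      map_add' := fun _ _ => rfl }
  map_id _ := rfl
  map_comp _ _ := rfl

variable [∀ U : Opens X, Module (SmoothFun I U) (S U)]

/-- A sheaf of modules over the smooth functions, whose sections over `U` form a subgroup `S U` of
the sections of a family `T` of abelian groups. -/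
noncomputable def sheafOfSections
    (hloc : ∀ (U : Opens X) (f : ∀ x : U, T x),
      (∀ x : U, ∃ (V : Opens X) (_ : x.1 ∈ V) (i : V ≤ U), restr i f ∈ S V) → f ∈ S U)
    (hsmul : ∀ {U V : Opens X} (i : V ≤ U) (r : SmoothFun I U) (f : S U),
      restr i (r • f : S U).1 =
        (SmoothFun.res I i r • (⟨restr i f.1, hres i f.1 f.2⟩ : S V) : S V).1) :
    SheafOfModules.{u} (smoothRingSheaf I X) where
  val :=
    letI (U : (Opens X)ᵒᵖ) : Module ((smoothRingSheaf I X).obj.obj U) ((abPresheaf T S hres).obj U) :=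
      inferInstanceAs (Module (SmoothFun I U.unop) (S U.unop))
    PresheafOfModules.ofPresheaf (R := (smoothRingSheaf I X).obj) (abPresheaf T S hres)
      fun _ _ i r f => Subtype.ext (hsmul i.unop.le r f)
  isSheaf := by
    rw [Presheaf.isSheaf_iff_isSheaf_forget _ _ (forget AddCommGrpCat)]
    exact isSheaf_of_local (fun U f => f ∈ S U) (fun i f h => hres i f h) hloc _ rfl

end


variable (X) in
/-- A smooth real vector bundle of finite rank (with a model fibre `F`). -/
structure SmoothVectorBundle where
  /-- the model fibre -/
  F : Type u
  /-- the fibres -/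
  E : X → Type u
  [normedAddCommGroup : NormedAddCommGroup F]
  [normedSpace : NormedSpace ℝ F]
  [finiteDimensional : FiniteDimensional ℝ F]
  [addCommGroup : ∀ x, AddCommGroup (E x)]
  [module : ∀ x, Module ℝ (E x)]
  [topologicalSpace : ∀ x, TopologicalSpace (E x)]
  [isTopologicalAddGroup : ∀ x, IsTopologicalAddGroup (E x)]
  [continuousSMul : ∀ x, ContinuousSMul ℝ (E x)]
  [topologicalSpaceTotalSpace : TopologicalSpace (Bundle.TotalSpace F E)]
  [fiberBundle : FiberBundle F E]
  [vectorBundle : VectorBundle ℝ F E]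
  [contMDiffVectorBundle : ContMDiffVectorBundle ∞ F E I]

namespace SmoothVectorBundle

attribute [instance] normedAddCommGroup normedSpace finiteDimensional addCommGroup module
  topologicalSpace isTopologicalAddGroup continuousSMul topologicalSpaceTotalSpace fiberBundle
  vectorBundle contMDiffVectorBundle

end SmoothVectorBundle

variable {I}

/-- Smoothness of a section over an open subset, as a map to the total space. -/
def IsSmooth (V : SmoothVectorBundle I X) {U : Opens X} (s : ∀ x : U, V.E x) : Prop :=
  ContMDiff I (I.prod 𝓘(ℝ, V.F)) ∞ fun x : U => Bundle.TotalSpace.mk' V.F (x : X) (s x)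

section IsSmooth

variable {V : SmoothVectorBundle I X} {U W : Opens X}

lemma IsSmooth.restr {s : ∀ x : U, V.E x} (hs : IsSmooth V s) (i : W ≤ U) :
    IsSmooth V (restr i s) :=
  ContMDiff.comp hs (contMDiff_inclusion i)

lemma isSmooth_of_locally (s : ∀ x : U, V.E x)
    (h : ∀ x : U, ∃ (W : Opens X) (_ : x.1 ∈ W) (i : W ≤ U), IsSmooth V (restr i s)) :
    IsSmooth V s :=
  contMDiff_of_locally I _ h

/-- Smoothness in the preferred trivialization. -/
lemma isSmooth_iff {s : ∀ x : U, V.E x} : IsSmooth V s ↔ ∀ x : U, ContMDiffAt I 𝓘(ℝ, V.F) ∞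
    (fun y : U => (trivializationAt V.F V.E (x : X) ⟨y, s y⟩).2) x := by
  refine forall_congr' fun x => ?_
  rw [Bundle.contMDiffAt_totalSpace]
  exact and_iff_right contMDiff_subtype_val.contMDiffAt

lemma eventually_mem_baseSet (x : U) :
    ∀ᶠ y : U in nhds x, (y : X) ∈ (trivializationAt V.F V.E (x : X)).baseSet :=
  continuous_subtype_val.continuousAt.eventually_mem
    ((trivializationAt V.F V.E (x : X)).open_baseSet.mem_nhds
      (FiberBundle.mem_baseSet_trivializationAt' _))

lemma isSmooth_zero : IsSmooth V (0 : ∀ x : U, V.E x) := by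
  rw [isSmooth_iff]
  intro x
  refine (contMDiffAt_const (c := (0 : V.F))).congr_of_eventuallyEq ?_
  filter_upwards [eventually_mem_baseSet (V := V) x] with y hy
  exact ((trivializationAt V.F V.E (x : X)).linear ℝ hy).map_zero

lemma IsSmooth.add {s s' : ∀ x : U, V.E x} (hs : IsSmooth V s) (hs' : IsSmooth V s') :
    IsSmooth V (s + s') := by
  rw [isSmooth_iff] at *
  intro x
  refine ((hs x).add (hs' x)).congr_of_eventuallyEq ?_
  filter_upwards [eventually_mem_baseSet (V := V) x] with y hy
  exact ((trivializationAt V.F V.E (x : X)).linear ℝ hy).map_add _ _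

lemma IsSmooth.smul {f : U → ℝ} {s : ∀ x : U, V.E x} (hf : ContMDiff I 𝓘(ℝ, ℝ) ∞ f)
    (hs : IsSmooth V s) : IsSmooth V (fun x => f x • s x) := by
  rw [isSmooth_iff] at *
  intro x
  refine ((hf x).smul (hs x)).congr_of_eventuallyEq ?_
  filter_upwards [eventually_mem_baseSet (V := V) x] with y hy
  exact ((trivializationAt V.F V.E (x : X)).linear ℝ hy).map_smul _ _

lemma IsSmooth.congr' {s s' : ∀ x : U, V.E x} (hs : IsSmooth V s) (h : ∀ x, s x = s' x) :
    IsSmooth V s' := by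
  rwa [← funext h]

lemma IsSmooth.neg {s : ∀ x : U, V.E x} (hs : IsSmooth V s) : IsSmooth V (-s) := by
  have := IsSmooth.smul (f := fun _ => -1) contMDiff_const hs
  simp only [neg_smul, one_smul] at this
  exact this

end IsSmooth

/-- The smooth sections of a vector bundle over an open subset. -/
def Sec (V : SmoothVectorBundle I X) (U : Opens X) : AddSubgroup (∀ x : U, V.E x) where
  carrier := {s | IsSmooth V s}
  zero_mem' := isSmooth_zero
  add_mem' := IsSmooth.add
  neg_mem' := IsSmooth.neg

namespace Sec

variable {V : SmoothVectorBundle I X} {U W : Opens X}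

instance : CoeFun (Sec V U) fun _ => ∀ x : U, V.E x where
  coe s := s.1

@[ext]
lemma ext {s s' : Sec V U} (h : ∀ x, s x = s' x) : s = s' := Subtype.ext (funext h)

noncomputable instance : SMul (SmoothFun I U) (Sec V U) where
  smul f s := ⟨fun x => f x • s x, IsSmooth.smul f.contMDiff s.2⟩

@[simp] lemma smul_apply (f : SmoothFun I U) (s : Sec V U) (x : U) : (f • s) x = f x • s x := rfl
@[simp] lemma add_apply (s s' : Sec V U) (x : U) : (s + s' : Sec V U) x = s x + s' x := rfl
@[simp] lemma zero_apply (x : U) : (0 : Sec V U) x = 0 := rfl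
@[simp] lemma neg_apply (s : Sec V U) (x : U) : (-s : Sec V U) x = -s x := rfl

noncomputable instance : Module (SmoothFun I U) (Sec V U) where
  one_smul s := by ext x; simp
  mul_smul f g s := by ext x; simp [mul_smul]
  smul_zero f := by ext x; simp
  smul_add f s s' := by ext x; simp
  add_smul f g s := by ext x; simp [add_smul]
  zero_smul s := by ext x; simp

/-- Restriction of sections. -/
def res (i : W ≤ U) (s : Sec V U) : Sec V W := ⟨restr i s.1, IsSmooth.restr s.2 i⟩

@[simp] lemma res_apply (i : W ≤ U) (s : Sec V U) (x : W) : res i s x = s ⟨x, i x.2⟩ := rfl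

end Sec

/-- The sheaf of smooth sections of a vector bundle. -/
noncomputable def SmoothVectorBundle.sheaf (V : SmoothVectorBundle I X) :
    SheafOfModules.{u} (smoothRingSheaf I X) :=
  sheafOfSections I V.E (Sec V) (fun i f hf => IsSmooth.restr (V := V) (s := f) hf i)
    (fun _ f h => isSmooth_of_locally f h) (fun _ _ _ => rfl)


section Cotangent

lemma contMDiffAt_clm_of_apply {G G' : Type*} [NormedAddCommGroup G] [NormedSpace ℝ G]
    [FiniteDimensional ℝ G] [NormedAddCommGroup G'] [NormedSpace ℝ G'] {U : Opens X}
    {f : U → G →L[ℝ] G'} {x : U} (h : ∀ e, ContMDiffAt I 𝓘(ℝ, G') ∞ (fun y => f y e) x) :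
    ContMDiffAt I 𝓘(ℝ, G →L[ℝ] G') ∞ f x := by
  have hd : Module.finrank ℝ G = Module.finrank ℝ (Fin (Module.finrank ℝ G) → ℝ) := by simp
  let e₁ := ContinuousLinearEquiv.ofFinrankEq hd
  let e₂ := (e₁.arrowCongr (1 : G' ≃L[ℝ] G')).trans (ContinuousLinearEquiv.piRing (Fin _))
  have h1 : ContMDiffAt I 𝓘(ℝ, Fin (Module.finrank ℝ G) → G') ∞ (fun y => e₂ (f y)) x :=
    contMDiffAt_pi_space.2 fun i => h _
  have h2 := (e₂.symm.contDiff (n := ∞)).contMDiff.contMDiffAt.comp x h1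
  refine h2.congr_of_eventuallyEq (Filter.Eventually.of_forall fun y => ?_)
  exact (e₂.symm_apply_apply _).symm

variable [IsManifold I ∞ X]

/-- Smoothness of a vector field over an open subset. -/
def IsSmoothField {U : Opens X} (v : ∀ x : U, TangentSpace I (x : X)) : Prop :=
  ContMDiff I I.tangent ∞ fun x : U => (⟨x, v x⟩ : TangentBundle I X)

/-- The local extension of a tangent vector that is constant in a trivialization. -/
lemma isSmoothField_symmL (x₀ : X) (e : EM) {W : Opens X}
    (hW : ∀ x : W, (x : X) ∈ (trivializationAt EM (TangentSpace I : X → Type u) x₀).baseSet) :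
    IsSmoothField fun x : W =>
      (trivializationAt EM (TangentSpace I : X → Type u) x₀).symmL ℝ (x : X) e := by
  intro x
  have h := (trivializationAt EM (TangentSpace I : X → Type u) x₀).contMDiffAt_symmL (n := ∞)
    (IB := I) (hW x)
  have h' := (ContMDiffAt.clm_bundle_apply (n := ∞) (F₁ := EM) (E₁ := Bundle.Trivial X EM)
    (F₂ := EM) (E₂ := (TangentSpace I : X → Type u)) (b := fun y : W => (y : X))
    (v := fun _ => e) (x := x)
    (h.comp x contMDiff_subtype_val.contMDiffAt) (by
      rw [Bundle.contMDiffAt_totalSpace]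
      exact ⟨contMDiff_subtype_val.contMDiffAt, contMDiffAt_const⟩))
  exact h'

variable [FiniteDimensional ℝ EM]

/-- The bundle `T*X ⊗ V`, realised as the bundle of linear maps from the tangent bundle to `V`. -/
noncomputable def cotangentTensor (V : SmoothVectorBundle I X) : SmoothVectorBundle I X where
  F := EM →L[ℝ] V.F
  E x := TangentSpace I x →L[ℝ] V.E x

variable {V : SmoothVectorBundle I X} {U W : Opens X}

/-- A family of linear maps `T_x X → V_x` is smooth if its values on smooth local vector fields
are. -/
lemma isSmooth_cotangentTensor {σ : ∀ x : U, TangentSpace I (x : X) →L[ℝ] V.E x}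
    (h : ∀ (W : Opens X) (i : W ≤ U) (v : ∀ x : W, TangentSpace I (x : X)), IsSmoothField v →
      IsSmooth V fun x : W => σ ⟨x, i x.2⟩ (v x)) : IsSmooth (cotangentTensor V) σ := by
  classical
  refine isSmooth_iff.2 fun x₀ => ?_
  let e := trivializationAt EM (TangentSpace I : X → Type u) (x₀ : X)
  let W : Opens X := ⟨e.baseSet, e.open_baseSet⟩ ⊓ U
  have hx₀ : (x₀ : X) ∈ W := ⟨FiberBundle.mem_baseSet_trivializationAt' _, x₀.2⟩
  refine contMDiffAt_clm_of_apply fun v => ?_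
  have hs := isSmooth_iff.1 (h W inf_le_right _
    (isSmoothField_symmL (x₀ : X) v (W := W) fun x => x.2.1)) ⟨x₀, hx₀⟩
  let g : X → V.F := fun y => if hy : y ∈ U then
    (trivializationAt V.F V.E (x₀ : X) ⟨y, σ ⟨y, hy⟩ (e.symmL ℝ y v)⟩).2 else 0
  have hg (y : X) (hy : y ∈ U) : g y =
    (trivializationAt V.F V.E (x₀ : X) ⟨y, σ ⟨y, hy⟩ (e.symmL ℝ y v)⟩).2 := dif_pos hy
  have h1 : ContMDiffAt I 𝓘(ℝ, V.F) ∞ (fun y : W => g y) ⟨x₀, hx₀⟩ := by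
    refine hs.congr_of_eventuallyEq (Filter.Eventually.of_forall fun y => ?_)
    exact hg y y.2.2
  have h2 : ContMDiffAt I 𝓘(ℝ, V.F) ∞ (fun y : U => g y) x₀ :=
    contMDiffAt_subtype_iff.2
      ((contMDiffAt_subtype_iff (U := W) (x := ⟨x₀, hx₀⟩)).1 h1)
  refine h2.congr_of_eventuallyEq ?_
  filter_upwards [eventually_mem_baseSet (V := V) x₀] with y hy
  rw [hg y y.2]
  exact congrFun (Bundle.Trivialization.coe_linearMapAt_of_mem (R := ℝ)
    (trivializationAt V.F V.E (x₀ : X)) hy) _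

/-- Evaluation of a smooth section of `T*X ⊗ V` on a smooth vector field. -/
lemma IsSmooth.apply_field {σ : ∀ x : U, TangentSpace I (x : X) →L[ℝ] V.E x}
    (hσ : IsSmooth (cotangentTensor V) σ) {v : ∀ x : U, TangentSpace I (x : X)}
    (hv : IsSmoothField v) : IsSmooth V fun x => σ x (v x) :=
  fun x => ContMDiffAt.clm_bundle_apply (n := ∞) (F₁ := EM) (E₁ := (TangentSpace I : X → Type u))
    (F₂ := V.F) (E₂ := V.E) (b := fun y : U => (y : X)) (hσ x) (hv x)

end Cotangent


section Differential

variable {U W : Opens X}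

/-- The extension by zero of a function on an open subset. -/
noncomputable def extendZero (f : U → ℝ) : X → ℝ := Function.extend Subtype.val f 0

lemma extendZero_apply (f : U → ℝ) (x : U) : extendZero f x = f x :=
  Subtype.val_injective.extend_apply f _ x

lemma contMDiffAt_extendZero (f : SmoothFun I U) (x : U) :
    ContMDiffAt I 𝓘(ℝ, ℝ) ∞ (extendZero f) x := by
  refine (contMDiffAt_subtype_iff (U := U) (x := x)).1 ?_
  have : (fun y : U => extendZero f (y : X)) = f := funext (extendZero_apply f)
  rw [this]
  exact f.contMDiff x

lemma mdifferentiableAt_extendZero (f : SmoothFun I U) (x : U) :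
    MDifferentiableAt I 𝓘(ℝ, ℝ) (extendZero f) x :=
  (contMDiffAt_extendZero f x).mdifferentiableAt (by simp)

/-- The differential of a smooth function on an open subset at a point. -/
noncomputable def SmoothFun.d (f : SmoothFun I U) (x : U) : TangentSpace I (x : X) →L[ℝ] ℝ :=
  mvfderiv I (extendZero f) x

namespace SmoothFun

lemma d_eq_of_eventuallyEq (f : SmoothFun I U) (x : U) {g : X → ℝ}
    (h : ∀ᶠ y in nhds (x : X), extendZero f y = g y) : f.d x = mvfderiv I g (x : X) := by
  have h' : extendZero f =ᶠ[nhds (x : X)] g := h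
  unfold d mvfderiv
  rw [h'.mfderiv_eq, h'.eq_of_nhds]

lemma d_eq_of_eqOn (f : SmoothFun I U) (x : U) {g : X → ℝ} (h : ∀ y : U, f y = g y) :
    f.d x = mvfderiv I g (x : X) := by
  refine d_eq_of_eventuallyEq f x ?_
  filter_upwards [U.isOpen.mem_nhds x.2] with y hy
  exact (extendZero_apply f ⟨y, hy⟩).trans (h ⟨y, hy⟩)

lemma d_res (f : SmoothFun I U) (i : W ≤ U) (x : W) :
    (SmoothFun.res I i f).d x = f.d ⟨x, i x.2⟩ :=
  d_eq_of_eqOn _ x fun y => (extendZero_apply f ⟨y, i y.2⟩).symm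

lemma d_mul (f g : SmoothFun I U) (x : U) : (f * g).d x = f x • g.d x + g x • f.d x := by
  rw [d_eq_of_eqOn (f * g) x (g := extendZero f * extendZero g) fun y => by
    simp [extendZero_apply], mvfderiv_mul (mdifferentiableAt_extendZero f x)
    (mdifferentiableAt_extendZero g x), extendZero_apply, extendZero_apply]
  rfl

lemma d_add (f g : SmoothFun I U) (x : U) : (f + g).d x = f.d x + g.d x := by
  rw [d_eq_of_eqOn (f + g) x (g := extendZero f + extendZero g) fun y => by
    simp [extendZero_apply], mvfderiv_add (mdifferentiableAt_extendZero f x)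
    (mdifferentiableAt_extendZero g x)]
  rfl

lemma d_one (x : U) : (1 : SmoothFun I U).d x = 0 := by
  rw [d_eq_of_eqOn 1 x (g := fun _ => 1) fun y => rfl, mvfderiv_const]

lemma d_zero (x : U) : (0 : SmoothFun I U).d x = 0 := by
  rw [d_eq_of_eqOn 0 x (g := fun _ => 0) fun y => rfl, mvfderiv_const]

variable [IsManifold I ∞ X]

lemma contMDiff_d_apply (f : SmoothFun I U) {v : ∀ x : U, TangentSpace I (x : X)}
    (hv : IsSmoothField v) : ContMDiff I 𝓘(ℝ, ℝ) ∞ fun x => f.d x (v x) := by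
  intro x
  have h1 := (contMDiffAt_extendZero f x).mfderiv_const (m := ∞) (by simp)
  have h2 := h1.comp x (contMDiff_subtype_val (I := I) (n := ∞)).contMDiffAt
  have h3 := ContMDiffAt.clm_apply_of_inCoordinates (n := ∞) (F₁ := EM) (F₂ := ℝ)
    (E₁ := (TangentSpace I : X → Type u)) (E₂ := (TangentSpace 𝓘(ℝ, ℝ) : ℝ → Type))
    (b₁ := fun y : U => (y : X)) (b₂ := fun y : U => extendZero f y)
    (ϕ := fun y : U => mfderiv I 𝓘(ℝ, ℝ) (extendZero f) (y : X)) (v := v) (m₀ := x) h2 (hv x)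
    ((contMDiffAt_extendZero f x).comp x contMDiff_subtype_val.contMDiffAt)
  exact ((contMDiff_snd_tangentBundle_modelSpace ℝ 𝓘(ℝ, ℝ)).contMDiffAt).comp x h3

end SmoothFun

end Differential

section Connection

variable [FiniteDimensional ℝ EM] [IsManifold I ∞ X] {V : SmoothVectorBundle I X} {U W : Opens X}

/-- The section `df ⊗ s` of `T*X ⊗ V`, i.e. `v ↦ df(v) s`. -/
noncomputable def dTensor (f : SmoothFun I U) (s : Sec V U) : Sec (cotangentTensor V) U :=
  ⟨fun x => (f.d x).smulRight (s x), isSmooth_cotangentTensor fun _ i v hv =>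
    ((Sec.res i s).2.smul (f := fun x => (SmoothFun.res I i f).d x (v x))
      ((SmoothFun.res I i f).contMDiff_d_apply hv)).congr' fun x => by
        rw [SmoothFun.d_res]; rfl⟩

@[simp] lemma dTensor_apply (f : SmoothFun I U) (s : Sec V U) (x : U) :
    dTensor f s x = (f.d x).smulRight (s x) := rfl

lemma dTensor_eq {f : SmoothFun I U} {s : Sec V U} {τ : Sec (cotangentTensor V) U}
    (h : ∀ (x : U) (v : TangentSpace I (x : X)),
      f.d x v • s x = (show TangentSpace I (x : X) →L[ℝ] V.E x from τ x) v) : dTensor f s = τ :=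
  Sec.ext fun x => ContinuousLinearMap.ext fun v => h x v

lemma dTensor_one (s : Sec V U) : dTensor 1 s = 0 :=
  dTensor_eq fun x v => by rw [SmoothFun.d_one]; exact zero_smul ℝ _

lemma dTensor_zero_left (s : Sec V U) : dTensor 0 s = 0 :=
  dTensor_eq fun x v => by rw [SmoothFun.d_zero]; exact zero_smul ℝ _

lemma dTensor_add_left (f g : SmoothFun I U) (s : Sec V U) :
    dTensor (f + g) s = dTensor f s + dTensor g s :=
  dTensor_eq fun x v => by rw [SmoothFun.d_add]; exact add_smul _ _ _

lemma dTensor_mul (f g : SmoothFun I U) (s : Sec V U) :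
    dTensor (f * g) s = f • dTensor g s + dTensor f (g • s) :=
  dTensor_eq fun x v => by
    rw [SmoothFun.d_mul]
    change (f x * g.d x v + g x * f.d x v) • s x = f x • g.d x v • s x + f.d x v • g x • s x
    rw [add_smul, mul_smul, mul_smul, smul_comm (g x)]

lemma dTensor_zero_right (f : SmoothFun I U) : dTensor f (0 : Sec V U) = 0 :=
  dTensor_eq fun x v => smul_zero (f.d x v)

lemma dTensor_add_right (f : SmoothFun I U) (s s' : Sec V U) :
    dTensor f (s + s') = dTensor f s + dTensor f s' :=
  dTensor_eq fun x v => smul_add (f.d x v) (s x) (s' x)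

lemma res_dTensor (f : SmoothFun I U) (s : Sec V U) (i : W ≤ U) :
    Sec.res i (dTensor f s) = dTensor (SmoothFun.res I i f) (Sec.res i s) :=
  (dTensor_eq fun x v => by rw [SmoothFun.d_res]; rfl).symm

/-- A connection on a vector bundle `V`: a morphism of sheaves `∇ : V → T*X ⊗ V` that is additive
and satisfies the Leibniz rule. (The `ℝ`-linearity is the Leibniz rule for constant functions.) -/
@[ext]
structure Connection (V : SmoothVectorBundle I X) where
  /-- the covariant derivative of local sections -/
  toFun (U : Opens X) : Sec V U →+ Sec (cotangentTensor V) U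
  leibniz (U : Opens X) (f : SmoothFun I U) (s : Sec V U) :
    toFun U (f • s) = f • toFun U s + dTensor f s
  res_comm {U W : Opens X} (i : W ≤ U) (s : Sec V U) :
    Sec.res i (toFun U s) = toFun W (Sec.res i s)

end Connection

section Jets

variable [FiniteDimensional ℝ EM] [IsManifold I ∞ X] {U W : Opens X}

/-- The local sections of the first jet sheaf `J¹V = V ⊕ (T*X ⊗ V)`: pairs `(s, τ)` of a smooth
section of `V` and a smooth section of `T*X ⊗ V`. -/
def JetSec (V : SmoothVectorBundle I X) (U : Opens X) :
    AddSubgroup (∀ x : U, V.E x × (cotangentTensor V).E x) where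
  carrier := {j | IsSmooth V (fun x => (j x).1) ∧ IsSmooth (cotangentTensor V) fun x => (j x).2}
  zero_mem' := ⟨isSmooth_zero, isSmooth_zero⟩
  add_mem' h h' := ⟨h.1.add h'.1, h.2.add h'.2⟩
  neg_mem' h := ⟨h.1.neg, h.2.neg⟩

namespace JetSec

variable {V : SmoothVectorBundle I X}

/-- The jet `(s, τ)`. -/
def mk (s : Sec V U) (τ : Sec (cotangentTensor V) U) : JetSec V U :=
  ⟨fun x => (s x, τ x), s.2, τ.2⟩

/-- The component `s` of a jet `(s, τ)`. -/
def fst (j : JetSec V U) : Sec V U := ⟨fun x => (j.1 x).1, j.2.1⟩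

/-- The component `τ` of a jet `(s, τ)`. -/
def snd (j : JetSec V U) : Sec (cotangentTensor V) U := ⟨fun x => (j.1 x).2, j.2.2⟩

lemma ext {j j' : JetSec V U} (h : fst j = fst j') (h' : snd j = snd j') : j = j' :=
  Subtype.ext <| funext fun x => Prod.ext congr(($h).1 x) congr(($h').1 x)

@[simp] lemma fst_mk (s : Sec V U) (τ : Sec (cotangentTensor V) U) : fst (mk s τ) = s := rfl
@[simp] lemma snd_mk (s : Sec V U) (τ : Sec (cotangentTensor V) U) : snd (mk s τ) = τ := rfl
@[simp] lemma fst_add (j j' : JetSec V U) : fst (j + j') = fst j + fst j' := rfl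
@[simp] lemma snd_add (j j' : JetSec V U) : snd (j + j') = snd j + snd j' := rfl
@[simp] lemma fst_zero : fst (0 : JetSec V U) = 0 := rfl
@[simp] lemma snd_zero : snd (0 : JetSec V U) = 0 := rfl

/-- The scalar multiplication `f • (s, τ) = (f s, f τ + df ⊗ s)`. -/
noncomputable instance : SMul (SmoothFun I U) (JetSec V U) where
  smul f j := mk (f • fst j) (f • snd j + dTensor f (fst j))

@[simp] lemma fst_smul (f : SmoothFun I U) (j : JetSec V U) : fst (f • j) = f • fst j := rfl
@[simp] lemma snd_smul (f : SmoothFun I U) (j : JetSec V U) :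
    snd (f • j) = f • snd j + dTensor f (fst j) := rfl

noncomputable instance : Module (SmoothFun I U) (JetSec V U) where
  one_smul j := ext (by simp) (by simp [dTensor_one])
  mul_smul f g j := ext (by simp [mul_smul]) (by
    simp [mul_smul, dTensor_mul, add_assoc])
  smul_zero f := ext (by simp) (by simp [dTensor_zero_right])
  smul_add f j j' := ext (by simp) (by simp [dTensor_add_right, add_add_add_comm])
  add_smul f g j := ext (by simp [add_smul]) (by
    simp [add_smul, dTensor_add_left, add_add_add_comm])
  zero_smul j := ext (by simp) (by simp [dTensor_zero_left])

lemma mk_zero_add (τ τ' : Sec (cotangentTensor V) U) :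
    mk (0 : Sec V U) (τ + τ') = mk 0 τ + mk 0 τ' := ext (by simp) (by simp)

lemma mk_zero_smul (f : SmoothFun I U) (τ : Sec (cotangentTensor V) U) :
    mk (0 : Sec V U) (f • τ) = f • mk 0 τ := ext (by simp) (by simp [dTensor_zero_right])

/-- Restriction of jets. -/
def res (i : W ≤ U) (j : JetSec V U) : JetSec V W :=
  ⟨restr (T := fun x => V.E x × (cotangentTensor V).E x) i j.1,
    IsSmooth.restr j.2.1 i, IsSmooth.restr j.2.2 i⟩

@[simp] lemma fst_res (i : W ≤ U) (j : JetSec V U) : fst (res i j) = Sec.res i (fst j) := rfl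
@[simp] lemma snd_res (i : W ≤ U) (j : JetSec V U) : snd (res i j) = Sec.res i (snd j) := rfl

lemma res_smul (i : W ≤ U) (f : SmoothFun I U) (j : JetSec V U) :
    res i (f • j) = SmoothFun.res I i f • res i j := by
  refine ext rfl ?_
  rw [snd_smul, snd_res, fst_res, ← res_dTensor]
  rfl

end JetSec

/-- The first jet sheaf `J¹V` as a sheaf of modules over the smooth functions. -/
noncomputable def jetSheaf (V : SmoothVectorBundle I X) :
    SheafOfModules.{u} (smoothRingSheaf I X) :=
  sheafOfSections I (fun x => V.E x × (cotangentTensor V).E x) (JetSec V)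
    (fun i _ h => ⟨h.1.restr i, h.2.restr i⟩)
    (fun _ f h => ⟨isSmooth_of_locally (fun x => (f x).1) fun x => by
        obtain ⟨W, hx, i, h⟩ := h x
        exact ⟨W, hx, i, h.1⟩,
      isSmooth_of_locally (V := cotangentTensor V) (fun x => (f x).2) fun x => by
        obtain ⟨W, hx, i, h⟩ := h x
        exact ⟨W, hx, i, h.2⟩⟩)
    (fun i r j => congrArg Subtype.val (JetSec.res_smul i r j))

end Jets

section TwistedBundles

open TensorProduct

variable {Q₀ : Type w₀} {Q₁ : Type w₁}

/-- For a quiver with vertices `Q₀`, arrows `Q₁`, source `s` and target `t`, and vector bundles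
`M a` indexed by the arrows: an `M`-twisted quiver bundle, i.e. a smooth vector bundle `E i` for
each vertex and a smooth morphism of vector bundles `φ a : E (s a) ⊗ M a → E (t a)` for each
arrow. -/
structure TwistedQuiverBundle (s t : Q₁ → Q₀) (M : Q₁ → SmoothVectorBundle I X) where
  /-- the vector bundle at a vertex -/
  E : Q₀ → SmoothVectorBundle I X
  /-- the structure morphism of an arrow, fibrewise -/
  φ (a : Q₁) (x : X) : (E (s a)).E x ⊗[ℝ] (M a).E x →ₗ[ℝ] (E (t a)).E x
  smooth (a : Q₁) (U : Opens X) (e : Sec (E (s a)) U) (m : Sec (M a) U) :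
    IsSmooth (E (t a)) fun x : U => φ a x (e x ⊗ₜ[ℝ] m x)

namespace TwistedQuiverBundle

variable {s t : Q₁ → Q₀} {M : Q₁ → SmoothVectorBundle I X} (R : TwistedQuiverBundle s t M)
  {U W : Opens X}

/-- The section `φ a (e ⊗ m)`. -/
noncomputable def mapSec (a : Q₁) (e : Sec (R.E (s a)) U) (m : Sec (M a) U) : Sec (R.E (t a)) U :=
  ⟨fun x => R.φ a x (e x ⊗ₜ[ℝ] m x), R.smooth a U e m⟩

@[simp] lemma mapSec_apply (a : Q₁) (e : Sec (R.E (s a)) U) (m : Sec (M a) U) (x : U) :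
    R.mapSec a e m x = R.φ a x (e x ⊗ₜ[ℝ] m x) := rfl

lemma mapSec_add_left (a : Q₁) (e e' : Sec (R.E (s a)) U) (m : Sec (M a) U) :
    R.mapSec a (e + e') m = R.mapSec a e m + R.mapSec a e' m :=
  Sec.ext fun x => by simp [add_tmul]

lemma mapSec_add_right (a : Q₁) (e : Sec (R.E (s a)) U) (m m' : Sec (M a) U) :
    R.mapSec a e (m + m') = R.mapSec a e m + R.mapSec a e m' :=
  Sec.ext fun x => by simp [tmul_add]

lemma mapSec_smul_left (a : Q₁) (f : SmoothFun I U) (e : Sec (R.E (s a)) U) (m : Sec (M a) U) :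
    R.mapSec a (f • e) m = f • R.mapSec a e m :=
  Sec.ext fun x => by simp [← smul_tmul']

lemma mapSec_smul_right (a : Q₁) (f : SmoothFun I U) (e : Sec (R.E (s a)) U) (m : Sec (M a) U) :
    R.mapSec a e (f • m) = f • R.mapSec a e m :=
  Sec.ext fun x => by simp

/-- The twisted quiver sheaf of smooth sections of a twisted quiver bundle. -/
noncomputable def toSheaf : QuiverSheaf s t fun a => (M a).sheaf where
  obj i := (R.E i).sheaf
  map a :=
    { app := fun U => AddMonoidHom.mk'
        (fun e : Sec (R.E (s a)) U.unop => AddMonoidHom.mk'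
          (fun m : Sec (M a) U.unop => R.mapSec a e m) (R.mapSec_add_right a e))
        fun e e' => AddMonoidHom.ext fun m => R.mapSec_add_left a e e' m
      smul_left := fun _ f e m => R.mapSec_smul_left a f e m
      smul_right := fun _ f e m => R.mapSec_smul_right a f e m
      naturality := fun _ _ _ => rfl }

variable [FiniteDimensional ℝ EM]

/-- For a tangent covector with values in `E (s a)` and an element of `M a`, the covector
`(id ⊗ φ a) (τ ⊗ m)` with values in `E (t a)`, as a linear map `v ↦ φ a (τ v ⊗ m)`. -/
noncomputable def covLeft (a : Q₁) (x : X) (τ : TangentSpace I x →L[ℝ] (R.E (s a)).E x)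
    (m : (M a).E x) : TangentSpace I x →L[ℝ] (R.E (t a)).E x :=
  haveI : T2Space (TangentSpace I x) := inferInstanceAs (T2Space EM)
  haveI : FiniteDimensional ℝ (TangentSpace I x) := inferInstanceAs (FiniteDimensional ℝ EM)
  LinearMap.toContinuousLinearMap
    (R.φ a x ∘ₗ (TensorProduct.mk ℝ ((R.E (s a)).E x) ((M a).E x)).flip m ∘ₗ τ.toLinearMap)

/-- For an element of `E (s a)` and a tangent covector with values in `M a`, the covector
`(id ⊗ φ a) (e ⊗ μ)` with values in `E (t a)`, as a linear map `v ↦ φ a (e ⊗ μ v)`. -/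
noncomputable def covRight (a : Q₁) (x : X) (e : (R.E (s a)).E x)
    (μ : TangentSpace I x →L[ℝ] (M a).E x) : TangentSpace I x →L[ℝ] (R.E (t a)).E x :=
  haveI : T2Space (TangentSpace I x) := inferInstanceAs (T2Space EM)
  haveI : FiniteDimensional ℝ (TangentSpace I x) := inferInstanceAs (FiniteDimensional ℝ EM)
  LinearMap.toContinuousLinearMap
    (R.φ a x ∘ₗ TensorProduct.mk ℝ ((R.E (s a)).E x) ((M a).E x) e ∘ₗ μ.toLinearMap)

@[simp] lemma covLeft_apply (a : Q₁) (x : X) (τ : TangentSpace I x →L[ℝ] (R.E (s a)).E x)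
    (m : (M a).E x) (v : TangentSpace I x) : R.covLeft a x τ m v = R.φ a x (τ v ⊗ₜ[ℝ] m) := rfl

@[simp] lemma covRight_apply (a : Q₁) (x : X) (e : (R.E (s a)).E x)
    (μ : TangentSpace I x →L[ℝ] (M a).E x) (v : TangentSpace I x) :
    R.covRight a x e μ v = R.φ a x (e ⊗ₜ[ℝ] μ v) := rfl

variable [IsManifold I ∞ X]

lemma isSmooth_covLeft (a : Q₁) (τ : Sec (cotangentTensor (R.E (s a))) U) (m : Sec (M a) U) :
    IsSmooth (cotangentTensor (R.E (t a))) fun x : U => R.covLeft a x (τ x) (m x) :=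
  isSmooth_cotangentTensor fun W i _ hv =>
    R.smooth a W ⟨_, (Sec.res i τ).2.apply_field hv⟩ (Sec.res i m)

lemma isSmooth_covRight (a : Q₁) (e : Sec (R.E (s a)) U) (μ : Sec (cotangentTensor (M a)) U) :
    IsSmooth (cotangentTensor (R.E (t a))) fun x : U => R.covRight a x (e x) (μ x) :=
  isSmooth_cotangentTensor fun W i _ hv =>
    R.smooth a W (Sec.res i e) ⟨_, (Sec.res i μ).2.apply_field hv⟩

/-- The linear map `id ⊗ φ a` on a fibre of `(T*X ⊗ E (s a)) ⊗ M a`. -/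
noncomputable def cotangentMap (a : Q₁) (x : X) :
    (TangentSpace I x →L[ℝ] (R.E (s a)).E x) ⊗[ℝ] (M a).E x →ₗ[ℝ]
      (TangentSpace I x →L[ℝ] (R.E (t a)).E x) :=
  TensorProduct.lift <| LinearMap.mk₂ ℝ (R.covLeft a x)
    (fun τ τ' m => ContinuousLinearMap.ext fun v => by
      change R.φ a x ((τ v + τ' v) ⊗ₜ m) = R.φ a x (τ v ⊗ₜ m) + R.φ a x (τ' v ⊗ₜ m)
      rw [add_tmul, map_add])
    (fun c τ m => ContinuousLinearMap.ext fun v => by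
      change R.φ a x ((c • τ v) ⊗ₜ m) = c • R.φ a x (τ v ⊗ₜ m)
      rw [← smul_tmul', map_smul])
    (fun τ m m' => ContinuousLinearMap.ext fun v => by
      change R.φ a x (τ v ⊗ₜ (m + m')) = R.φ a x (τ v ⊗ₜ m) + R.φ a x (τ v ⊗ₜ m')
      rw [tmul_add, map_add])
    (fun c τ m => ContinuousLinearMap.ext fun v => by
      change R.φ a x (τ v ⊗ₜ (c • m)) = c • R.φ a x (τ v ⊗ₜ m)
      rw [tmul_smul, map_smul])

/-- The twisted quiver bundle `T*X ⊗ R`, with structure morphisms `id ⊗ φ a`. -/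
noncomputable def cotangent : TwistedQuiverBundle s t M where
  E i := cotangentTensor (R.E i)
  φ a x := R.cotangentMap a x
  smooth a _ τ m := R.isSmooth_covLeft a τ m

/-- A relative connection on a twisted quiver bundle: connections on the bundles at the vertices and
on the twisting bundles such that, for every arrow `a`, the morphism `φ a` intertwines the tensor
product connection `∇ ⊗ id + id ⊗ ∇` on `E (s a) ⊗ M a` with the connection on `E (t a)`. (The
condition is stated on the sections `e ⊗ m`, which locally generate.) -/
structure RelativeConnection where
  /-- the connections on the bundles at the vertices -/
  vertex (i : Q₀) : Connection (R.E i)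
  /-- the connections on the twisting bundles -/
  arrow (a : Q₁) : Connection (M a)
  compat (a : Q₁) (U : Opens X) (e : Sec (R.E (s a)) U) (m : Sec (M a) U) (x : U) :
    (vertex (t a)).toFun U (R.mapSec a e m) x =
      R.covLeft a x ((vertex (s a)).toFun U e x) (m x) +
        R.covRight a x (e x) ((arrow a).toFun U m x)

end TwistedQuiverBundle

end TwistedBundles

section JetSequence

open TensorProduct

variable [FiniteDimensional ℝ EM] [IsManifold I ∞ X] {Q₀ : Type w₀} {Q₁ : Type w₁}
  {s t : Q₁ → Q₀} {M : Q₁ → SmoothVectorBundle I X} (R : TwistedQuiverBundle s t M)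
  (D : ∀ a, Connection (M a)) {U W : Opens X}

namespace TwistedQuiverBundle

/-- The section `(id ⊗ φ a) (e ⊗ μ)` of `T*X ⊗ E (t a)`. -/
noncomputable def mapSecRight (a : Q₁) (e : Sec (R.E (s a)) U) (μ : Sec (cotangentTensor (M a)) U) :
    Sec (cotangentTensor (R.E (t a))) U :=
  ⟨fun x => R.covRight a x (e x) (μ x), R.isSmooth_covRight a e μ⟩

/-- The section `(id ⊗ φ a) (τ ⊗ m)` of `T*X ⊗ E (t a)`. -/
noncomputable def mapSecLeft (a : Q₁) (τ : Sec (cotangentTensor (R.E (s a))) U) (m : Sec (M a) U) :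
    Sec (cotangentTensor (R.E (t a))) U :=
  R.cotangent.mapSec a τ m

lemma mapSecLeft_dTensor (a : Q₁) (f : SmoothFun I U) (e : Sec (R.E (s a)) U)
    (m : Sec (M a) U) :
    R.mapSecLeft a (dTensor f e) m = dTensor f (R.mapSec a e m) :=
  (dTensor_eq fun x v => by
    change f.d x v • R.φ a x (e x ⊗ₜ[ℝ] m x) = R.φ a x ((f.d x v • e x) ⊗ₜ[ℝ] m x)
    rw [← smul_tmul', map_smul]).symm

lemma mapSecLeft_add_left (a : Q₁) (τ τ' : Sec (cotangentTensor (R.E (s a))) U)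
    (m : Sec (M a) U) : R.mapSecLeft a (τ + τ') m = R.mapSecLeft a τ m + R.mapSecLeft a τ' m :=
  R.cotangent.mapSec_add_left a τ τ' m

lemma mapSecLeft_add_right (a : Q₁) (τ : Sec (cotangentTensor (R.E (s a))) U)
    (m m' : Sec (M a) U) : R.mapSecLeft a τ (m + m') = R.mapSecLeft a τ m + R.mapSecLeft a τ m' :=
  R.cotangent.mapSec_add_right a τ m m'

lemma mapSecLeft_smul_left (a : Q₁) (f : SmoothFun I U) (τ : Sec (cotangentTensor (R.E (s a))) U)
    (m : Sec (M a) U) : R.mapSecLeft a (f • τ) m = f • R.mapSecLeft a τ m :=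
  R.cotangent.mapSec_smul_left a f τ m

lemma mapSecLeft_smul_right (a : Q₁) (f : SmoothFun I U) (τ : Sec (cotangentTensor (R.E (s a))) U)
    (m : Sec (M a) U) : R.mapSecLeft a τ (f • m) = f • R.mapSecLeft a τ m :=
  R.cotangent.mapSec_smul_right a f τ m

lemma mapSecRight_eq {a : Q₁} {e : Sec (R.E (s a)) U} {μ : Sec (cotangentTensor (M a)) U}
    {τ : Sec (cotangentTensor (R.E (t a))) U} (h : ∀ (x : U) (v : TangentSpace I (x : X)),
      R.φ a x (e x ⊗ₜ[ℝ] (show TangentSpace I (x : X) →L[ℝ] (M a).E x from μ x) v) =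
        (show TangentSpace I (x : X) →L[ℝ] (R.E (t a)).E x from τ x) v) :
    R.mapSecRight a e μ = τ :=
  Sec.ext fun x => ContinuousLinearMap.ext fun v => h x v

lemma mapSecRight_add_left (a : Q₁) (e e' : Sec (R.E (s a)) U)
    (μ : Sec (cotangentTensor (M a)) U) :
    R.mapSecRight a (e + e') μ = R.mapSecRight a e μ + R.mapSecRight a e' μ :=
  R.mapSecRight_eq fun x v => by rw [Sec.add_apply, add_tmul, map_add]; rfl

lemma mapSecRight_add_right (a : Q₁) (e : Sec (R.E (s a)) U)
    (μ μ' : Sec (cotangentTensor (M a)) U) :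
    R.mapSecRight a e (μ + μ') = R.mapSecRight a e μ + R.mapSecRight a e μ' :=
  R.mapSecRight_eq fun x _ =>
    (congrArg (R.φ a x) (tmul_add _ _ _)).trans (map_add (R.φ a x) _ _)

lemma mapSecRight_smul_left (a : Q₁) (f : SmoothFun I U) (e : Sec (R.E (s a)) U)
    (μ : Sec (cotangentTensor (M a)) U) :
    R.mapSecRight a (f • e) μ = f • R.mapSecRight a e μ :=
  R.mapSecRight_eq fun x v => by rw [Sec.smul_apply, ← smul_tmul', map_smul]; rfl

lemma mapSecRight_smul_right (a : Q₁) (f : SmoothFun I U) (e : Sec (R.E (s a)) U)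
    (μ : Sec (cotangentTensor (M a)) U) :
    R.mapSecRight a e (f • μ) = f • R.mapSecRight a e μ :=
  R.mapSecRight_eq fun x _ =>
    (congrArg (R.φ a x) (tmul_smul _ _ _)).trans (map_smul (R.φ a x) _ _)

lemma mapSecRight_dTensor (a : Q₁) (f : SmoothFun I U) (e : Sec (R.E (s a)) U)
    (m : Sec (M a) U) : R.mapSecRight a e (dTensor f m) = dTensor f (R.mapSec a e m) :=
  R.mapSecRight_eq fun x _ =>
    (congrArg (R.φ a x) (tmul_smul _ _ _)).trans (map_smul (R.φ a x) _ _)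

lemma res_mapSecRight (a : Q₁) (e : Sec (R.E (s a)) U) (μ : Sec (cotangentTensor (M a)) U)
    (i : W ≤ U) :
    Sec.res i (R.mapSecRight a e μ) = R.mapSecRight a (Sec.res i e) (Sec.res i μ) := rfl

/-- The structure morphism of the first jet quiver sheaf on sections:
`(s, τ) ⊗ m ↦ (φ a (s ⊗ m), (id ⊗ φ a) (τ ⊗ m + s ⊗ ∇ m))`. -/
noncomputable def jetMap (a : Q₁) (j : JetSec (R.E (s a)) U) (m : Sec (M a) U) :
    JetSec (R.E (t a)) U :=
  JetSec.mk (R.mapSec a (JetSec.fst j) m)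
    (R.mapSecLeft a (JetSec.snd j) m + R.mapSecRight a (JetSec.fst j) ((D a).toFun U m))

lemma jetMap_add_left (a : Q₁) (j j' : JetSec (R.E (s a)) U) (m : Sec (M a) U) :
    R.jetMap D a (j + j') m = R.jetMap D a j m + R.jetMap D a j' m :=
  JetSec.ext (by simp [jetMap, mapSec_add_left]) (by
    simp [jetMap, mapSecLeft_add_left, mapSecRight_add_left, add_add_add_comm])

lemma jetMap_add_right (a : Q₁) (j : JetSec (R.E (s a)) U) (m m' : Sec (M a) U) :
    R.jetMap D a j (m + m') = R.jetMap D a j m + R.jetMap D a j m' :=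
  JetSec.ext (by simp [jetMap, mapSec_add_right]) (by
    simp [jetMap, mapSecLeft_add_right, mapSecRight_add_right, add_add_add_comm])

lemma jetMap_smul_left (a : Q₁) (f : SmoothFun I U) (j : JetSec (R.E (s a)) U) (m : Sec (M a) U) :
    R.jetMap D a (f • j) m = f • R.jetMap D a j m :=
  JetSec.ext (by simp [jetMap, mapSec_smul_left]) (by
    simp only [jetMap, JetSec.fst_smul, JetSec.snd_smul, JetSec.snd_mk, JetSec.fst_mk,
      mapSecLeft_add_left, mapSecLeft_smul_left, mapSecRight_smul_left, mapSecLeft_dTensor,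
      smul_add]
    abel)

lemma jetMap_smul_right (a : Q₁) (f : SmoothFun I U) (j : JetSec (R.E (s a)) U)
    (m : Sec (M a) U) : R.jetMap D a j (f • m) = f • R.jetMap D a j m :=
  JetSec.ext (by simp [jetMap, mapSec_smul_right]) (by
    simp only [jetMap, JetSec.snd_smul, JetSec.snd_mk, JetSec.fst_mk, mapSecLeft_smul_right,
      (D a).leibniz, mapSecRight_add_right, mapSecRight_smul_right, mapSecRight_dTensor, smul_add]
    abel)

lemma res_jetMap (a : Q₁) (j : JetSec (R.E (s a)) U) (m : Sec (M a) U) (i : W ≤ U) :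
    JetSec.res i (R.jetMap D a j m) = R.jetMap D a (JetSec.res i j) (Sec.res i m) := by
  refine JetSec.ext rfl ?_
  simp only [jetMap, JetSec.snd_mk, JetSec.snd_res, JetSec.fst_res, ← (D a).res_comm]
  rfl

/-- The first jet twisted quiver bundle `J¹R` with respect to connections on the twisting bundles,
as a twisted quiver sheaf. -/
noncomputable def jet : QuiverSheaf s t fun a => (M a).sheaf where
  obj i := jetSheaf (R.E i)
  map a :=
    { app := fun U => AddMonoidHom.mk'
        (fun j : JetSec (R.E (s a)) U.unop => AddMonoidHom.mk'
          (fun m : Sec (M a) U.unop => R.jetMap D a j m) (R.jetMap_add_right D a j))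
        fun j j' => AddMonoidHom.ext fun m => R.jetMap_add_left D a j j' m
      smul_left := fun _ f j m => R.jetMap_smul_left D a f j m
      smul_right := fun _ f j m => R.jetMap_smul_right D a f j m
      naturality := fun i j m => R.res_jetMap D a j m i.unop.le }

lemma jetMap_mk_zero (a : Q₁) (τ : Sec (cotangentTensor (R.E (s a))) U) (m : Sec (M a) U) :
    R.jetMap D a (JetSec.mk 0 τ) m = JetSec.mk 0 (R.mapSecLeft a τ m) := by
  refine JetSec.ext (Sec.ext fun x => ?_) (Sec.ext fun x => ?_)
  · exact (congrArg (R.φ a x) (zero_tmul _ _)).trans (map_zero _)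
  · refine ContinuousLinearMap.ext fun v => ?_
    change R.φ a x _ + R.φ a x ((0 : (R.E (s a)).E x) ⊗ₜ[ℝ] _) = R.φ a x _
    rw [zero_tmul, map_zero, add_zero]
    rfl

/-- The inclusion `α : T*X ⊗ R → J¹R`, `τ ↦ (0, τ)`. -/
noncomputable def jetι : R.cotangent.toSheaf ⟶ R.jet D where
  app i := mkHom
    (fun U => AddMonoidHom.mk'
      (fun τ : Sec (cotangentTensor (R.E i)) U.unop => JetSec.mk (0 : Sec (R.E i) U.unop) τ)
      JetSec.mk_zero_add)
    (fun _ f τ => JetSec.mk_zero_smul f τ) (fun _ _ => rfl)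
  comm a := BilinHom.ext_app fun _ τ m => (R.jetMap_mk_zero D a τ m).symm

/-- The projection `β : J¹R → R`, `(s, τ) ↦ s`. -/
noncomputable def jetπ : R.jet D ⟶ R.toSheaf where
  app i := mkHom
    (fun U => AddMonoidHom.mk' (fun j : JetSec (R.E i) U.unop => JetSec.fst j) fun _ _ => rfl)
    (fun _ _ _ => rfl) (fun _ _ => rfl)
  comm _ := rfl

lemma jetι_comp_jetπ : R.jetι D ≫ R.jetπ D = 0 := by
  ext1 i
  exact hom_ext_ev fun _ _ => rfl

/-- The first jet sequence `0 → T*X ⊗ R → J¹R → R → 0`. -/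
noncomputable def jetSequence : ShortComplex (QuiverSheaf s t fun a => (M a).sheaf) :=
  ShortComplex.mk (R.jetι D) (R.jetπ D) (R.jetι_comp_jetπ D)

lemma ev_jetι_injective (i : Q₀) (U : (Opens X)ᵒᵖ) :
    Function.Injective (ev ((R.jetι D).app i) U) := fun _ _ h =>
  congrArg (JetSec.snd (V := R.E i) (U := U.unop)) h

lemma ev_jetπ_surjective (i : Q₀) (U : (Opens X)ᵒᵖ) :
    Function.Surjective (ev ((R.jetπ D).app i) U) := fun e =>
  ⟨JetSec.mk (V := R.E i) (U := U.unop) e 0, rfl⟩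

lemma jetSequence_shortExact : (R.jetSequence D).ShortExact where
  exact := ShortComplex.exact_of_f_is_kernel _ <| QuiverSheaf.isLimitOfApp (R.jetι D) (R.jetπ D)
    (R.jetι_comp_jetπ D) (fun i => mono_of_ev_injective _ (R.ev_jetι_injective D i)) fun i =>
      exact_of_ev _ _ _ (R.ev_jetι_injective D i) fun U j hj =>
        ⟨JetSec.snd (V := R.E i) (U := U.unop) j,
          JetSec.ext (V := R.E i) (U := U.unop) hj.symm rfl⟩
  mono_f := QuiverSheaf.mono_of_app _ fun i => mono_of_ev_injective _ (R.ev_jetι_injective D i)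
  epi_g := QuiverSheaf.epi_of_app _ fun i => epi_of_ev_surjective _ (R.ev_jetπ_surjective D i)

/-- The connecting homomorphism `δ : Hom(R, R) → Ext¹(R, T*X ⊗ R)` of the long exact sequence
obtained by applying `Hom(R, -)` to the first jet sequence. -/
noncomputable def connecting : (R.toSheaf ⟶ R.toSheaf) →+
    Abelian.Ext.{max (u + 1) w₀ w₁} R.toSheaf R.cotangent.toSheaf 1 :=
  ((R.jetSequence_shortExact D).extClass.postcomp R.toSheaf (zero_add 1)).comp
    (Abelian.Ext.addEquiv₀.symm.toAddMonoidHom)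

/-- The Atiyah class of a twisted quiver bundle: the image of the identity under the connecting
homomorphism. -/
noncomputable def atiyahClass : Abelian.Ext.{max (u + 1) w₀ w₁} R.toSheaf R.cotangent.toSheaf 1 :=
  R.connecting D (𝟙 R.toSheaf)

end TwistedQuiverBundle

end JetSequence

end Manifold
end TwistedQuiver

/-! The jet module `J¹E = E ⊕ (T*X ⊗ E)` is a direct sum of abelian sheaves, but not of modules: the
product `f • (s, τ) = (f s, f τ + df ⊗ s)` carries the extra term `df ⊗ s`. A section of `β` at a
vertex is necessarily of the form `s ↦ (s, ∇ s)`. Comparing second components, its additivity,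
linearity over the smooth functions and compatibility with restriction say that `∇` is additive,
satisfies the Leibniz rule and commutes with restriction. So sections of `J¹E → E` are the same
thing as connections on `E`; this is the content of `Connection.jetSection` and
`Connection.ofJetSection`.

The arrows are treated in the same way. The family of sections defined by connections `∇ i` is a
morphism of quiver sheaves if it commutes with the structure morphisms. On `e ⊗ m` both sides have
first component `φ a (e ⊗ m)`. The second components are `∇ (φ a (e ⊗ m))` on one side and `(id ⊗ φ
a) (∇ e ⊗ m + e ⊗ ∇ m)` on the other, where `∇ m` is taken with the connection on `M a` used to
build the jets. Their equality is the defining condition of a relative connection with that arrow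
part. Hence sections of `β` in the category of twisted quiver sheaves correspond to relative
connections whose arrow part is prescribed, and in an abelian category a section of a short exact
sequence amounts to a splitting. This gives `nonempty_splitting_iff`.

The Atiyah class enters by homological algebra alone. The connecting map is composition with the
extension class of the jet sequence, so its value at the identity is that class
(`atiyahClass_eq_extClass`). By exactness of the long sequence at `Hom(R, R)`, the class vanishes
exactly when the identity of `R` lifts along `β`, that is, when the sequence splits
(`extClass_eq_zero_iff`). -/

namespace TwistedQuiver

open CategoryTheory Opposite TopologicalSpace
open scoped Manifold

/-! ### Extension classes and splittings in an abelian category -/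

/-- For a short exact sequence in an abelian category, its extension class vanishes if and only if
the sequence splits. -/
lemma extClass_eq_zero_iff {C : Type*} [Category* C] [Abelian C] [HasExt.{w₀} C]
    {S : ShortComplex C} (hS : S.ShortExact) :
    hS.extClass = 0 ↔ Nonempty S.Splitting := by
  constructor
  · intro h
    -- The connecting map sends the identity of `S.X₃`, viewed in degree 0, to the extension class,
    -- which is zero by assumption. Exactness of the long sequence then lifts the identity through
    -- `S.g`.
    obtain ⟨x, hx⟩ := Abelian.Ext.covariant_sequence_exact₃ S.X₃ hS
      (Abelian.Ext.mk₀ (𝟙 S.X₃)) (zero_add 1) (by rw [Abelian.Ext.mk₀_id_comp, h])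
    -- Since `Ext⁰` is `Hom`, the lift is an actual morphism `σ`, and the equation `hx` descends to
    -- `σ ≫ S.g = 𝟙`. The retraction of the splitting comes from exactness: `𝟙 - S.g ≫ σ` is killed
    -- by `S.g`, hence factors through the monomorphism `S.f`.
    obtain ⟨σ, rfl⟩ := (Abelian.Ext.mk₀_bijective _ _).2 x
    rw [Abelian.Ext.mk₀_comp_mk₀] at hx
    exact ⟨.ofExactOfSection S hS.exact σ ((Abelian.Ext.mk₀_bijective _ _).1 hx) hS.mono_f⟩
  · rintro ⟨p⟩
    -- Writing the identity of `S.X₃` as `p.s ≫ S.g` makes the class factor through the composite of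
    -- `S.g` with the class, and two consecutive maps of the long exact sequence compose to zero.
    rw [← Abelian.Ext.mk₀_id_comp hS.extClass, ← p.s_g, ← Abelian.Ext.mk₀_comp_mk₀_assoc,
      hS.comp_extClass, Abelian.Ext.comp_zero]

/-! ### Connections as sections of the first jet sheaf -/

section JetSequence

variable {EM : Type u} [NormedAddCommGroup EM] [NormedSpace ℝ EM] [FiniteDimensional ℝ EM]
  {H : Type v} [TopologicalSpace H] {I : ModelWithCorners ℝ EM H} {X : Type u} [TopologicalSpace X]
  [ChartedSpace H X] [IsManifold I ∞ X] {Q₀ : Type w₀} {Q₁ : Type w₁} {s t : Q₁ → Q₀}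
  {M : Q₁ → SmoothVectorBundle I X}

/-- The section `s ↦ (s, ∇ s)` of the projection of the first jet sheaf defined by a connection. -/
noncomputable def Connection.jetSection {V : SmoothVectorBundle I X} (N : Connection V) :
    V.sheaf ⟶ jetSheaf V :=
  mkHom
    (fun U => AddMonoidHom.mk'
      (fun e : Sec V U.unop => JetSec.mk e (N.toFun U.unop e))
      fun e e' => JetSec.ext rfl (map_add (N.toFun U.unop) e e'))
    -- The operator `∇` is not linear over functions, but `s ↦ (s, ∇ s)` is: the defect `df ⊗ s` in
    -- the Leibniz rule is the term added by scalar multiplication of jets.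
    (fun U f e => JetSec.ext (V := V) (U := U.unop) rfl (N.leibniz U.unop f e))
    (fun {_ W} i e => JetSec.ext (V := V) (U := W.unop) rfl (N.res_comm i.unop.le e).symm)

/-- The connection defined by a section of the projection of the first jet sheaf. -/
noncomputable def Connection.ofJetSection {V : SmoothVectorBundle I X} (σ : V.sheaf ⟶ jetSheaf V)
    (hσ : ∀ (U : Opens X) (e : Sec V U), JetSec.fst (V := V) (U := U) (ev σ (op U) e) = e) :
    Connection V where
  toFun U := AddMonoidHom.mk' (fun e => JetSec.snd (V := V) (U := U) (ev σ (op U) e))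
    fun e e' => congrArg (JetSec.snd (V := V) (U := U)) (map_add (ev σ (op U)) e e')
  leibniz U f e := by
    -- The type ascription views the value of `σ` as a jet, so that its scalar multiplication is the
    -- twisted one of `JetSec`.
    let j : JetSec V U := ev σ (op U) e
    have hj : JetSec.fst j = e := hσ U e
    have h : ev σ (op U) (f • e : Sec V U) = (f • j : JetSec V U) := (ev σ (op U)).map_smul f e
    -- The second component of `f • j` is `f • snd j + dTensor f (fst j)`. That `σ` is a section is
    -- needed here: it identifies `fst j` with `e` and turns linearity into the Leibniz rule.
    refine (congrArg (JetSec.snd (V := V) (U := U)) h).trans ?_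
    rw [JetSec.snd_smul, hj]
    rfl
  res_comm {U W} i e :=
    (congrArg (JetSec.snd (V := V) (U := W)) (ev_res σ (homOfLE i).op e)).symm

/-! ### Relative connections as sections of the jet sequence of quiver sheaves -/

namespace TwistedQuiverBundle

variable (R : TwistedQuiverBundle s t M) (D : ∀ a, Connection (M a))

/-- The Atiyah class is the extension class of the first jet sequence. -/
lemma atiyahClass_eq_extClass : R.atiyahClass D = (R.jetSequence_shortExact D).extClass :=
  -- By definition the connecting map places a morphism in `Ext⁰` and composes it with the extension
  -- class; at the identity this composition does nothing.
  Abelian.Ext.mk₀_id_comp _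

/-- A section of the first jet sequence defined by a relative connection. -/
noncomputable def RelativeConnection.jetSection (N : R.RelativeConnection) :
    R.toSheaf ⟶ R.jet N.arrow where
  app i := (N.vertex i).jetSection
  comm a := BilinHom.ext_app fun U e m =>
    -- Only the second components carry information, and there the square is the compatibility
    -- condition. It matches because the target jets are built from `N.arrow`, the same connections
    -- on the twisting bundles that occur in `N.compat`.
    JetSec.ext (V := R.E (t a)) (U := U.unop) rfl (Sec.ext fun x => N.compat a U.unop e m x)

lemma RelativeConnection.jetSection_comp_jetπ (N : R.RelativeConnection) :
    N.jetSection R ≫ R.jetπ N.arrow = 𝟙 R.toSheaf := by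
  ext1 i
  exact hom_ext_ev fun _ _ => rfl

variable {R D} in
/-- The relative connection defined by a section of the first jet sequence. -/
noncomputable def relativeConnectionOfSection (σ : R.toSheaf ⟶ R.jet D)
    (hσ : σ ≫ R.jetπ D = 𝟙 R.toSheaf) : R.RelativeConnection :=
  have h (i : Q₀) (U : Opens X) (e : Sec (R.E i) U) :
      JetSec.fst (V := R.E i) (U := U) (ev (σ.app i) (op U) e) = e :=
    -- On sections `β` takes the first component, so the equation `hσ`, read at the vertex `i`, says
    -- that the first component of `σ e` is `e`.
    congr(ev (QuiverSheaf.Hom.app $hσ i) (op U) e)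
  { vertex i := .ofJetSection (σ.app i) (h i)
    arrow := D
    compat a U e m x := by
      -- The vertices alone would give unrelated connections. The compatibility comes from `σ`
      -- commuting with the structure morphism of `a`, read in the second component at the point
      -- `x`.
      have h1 := congr((JetSec.snd (V := R.E (t a)) (U := U)
        (BilinHom.app $(σ.comm a) (op U) e m)) x)
      have h2 := h (s a) U e
      refine h1.trans ?_
      -- Unfolding `jetMap` shows the term `e ⊗ ∇ m` with the first component of `σ e` in place of
      -- `e`; the section property `h2` removes the difference.
      change R.covLeft a x _ (m x) + R.covRight a x (JetSec.fst (V := R.E (s a)) (U := U)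
        (ev (σ.app (s a)) (op U) e) x) _ = _
      rw [h2]
      rfl }

/-- A splitting is used only through its section, and conversely a section of a short exact sequence
determines a splitting. The statement thus reduces to the dictionary between sections of the jet
sequence and relative connections. -/
theorem nonempty_splitting_iff : Nonempty (R.jetSequence D).Splitting ↔
    ∃ N : R.RelativeConnection, N.arrow = D := by
  constructor
  · rintro ⟨p⟩
    -- The arrow part of the relative connection built from a section is `D` by construction, so the
    -- second condition is definitional.
    exact ⟨relativeConnectionOfSection p.s p.s_g, rfl⟩
  -- Substituting `N.arrow` for `D` makes the jet sequence the one in which `N.jetSection` takes its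
  -- values, so no transport between jet quiver sheaves is needed.
  · rintro ⟨N, rfl⟩
    have h := R.jetSequence_shortExact N.arrow
    exact ⟨.ofExactOfSection _ h.exact (N.jetSection R) (N.jetSection_comp_jetπ R) h.mono_f⟩

end TwistedQuiverBundle

end JetSequence

end TwistedQuiver

/-! ### The equivalence of the three conditions -/

theorem propositionP {EM : Type u} [NormedAddCommGroup EM] [NormedSpace ℝ EM]
    [FiniteDimensional ℝ EM] {H : Type v} [TopologicalSpace H] {I : ModelWithCorners ℝ EM H}
    [I.Boundaryless] {X : Type u} [TopologicalSpace X] [ChartedSpace H X] [IsManifold I ∞ X]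
    [T2Space X] [SecondCountableTopology X] [ConnectedSpace X]
    {Q₀ : Type w₀} {Q₁ : Type w₁} [Finite Q₀] [Finite Q₁] {s t : Q₁ → Q₀}
    (M : Q₁ → TwistedQuiver.SmoothVectorBundle I X)
    (D : ∀ a : Q₁, TwistedQuiver.Connection (M a))
    (R : TwistedQuiver.TwistedQuiverBundle s t M) :
    List.TFAE [
      Nonempty (R.jetSequence D).Splitting,
      ∃ N : R.RelativeConnection, N.arrow = D,
      R.atiyahClass D = 0] := by
  tfae_have 1 ↔ 2 := R.nonempty_splitting_iff D
  tfae_have 3 ↔ 1 := by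
    rw [R.atiyahClass_eq_extClass D]
    exact TwistedQuiver.extClass_eq_zero_iff _
  tfae_finish
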